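/- Work in the projective plane over $\mathbb{K}=\mathbb{R}$ or $\mathbb{C}$. For a sequence $P=(p_n)_{n\in\mathbb{Z}/m}$ of points let $\vee_i(P)$ be the sequence of lines $(p_n\vee p_{n+i})_n$, and for a sequence $L=(l_n)_{n\in\mathbb{Z}/m}$ of lines let $\wedge_i(L)$ be the sequence of points $(l_n\wedge l_{n-i})_n$. A Poncelet $m$-gon ($m\ge 3$) is a sequence $P=(p_n)_{n\in\mathbb{Z}/m}$ of $m$ distinct points on a nondegenerate conic such that all lines of $\vee_1(P)$ are tangent to a second nondegenerate conic. Let $P$ be a Poncelet $m$-gon and let $a_1,b_1,\dots,a_k,b_k$ ($k\ge 1$) be positive integers strictly smaller than $m/2$ such that cyclically adjacent entries are distinct and $[a_1,\dots,a_k]=[b_1,\dots,b_k]$ as multisets. Put $P_0=P$, $L_j=\vee_{a_j}(P_{j-1})$ and $P_j=\wedge_{b_j}(L_j)$ for $1\le j\le k$. Then: (1) $P_k=\wedge_{b_k}\vee_{a_k}\cdots\wedge_{b_1}\vee_{a_1}(P)=P$ (as indexed sequences). (2) All joins and meets in the construction are joins of distinct points and meets of distinct lines, and the rings $P_0,\dots,P_{k-1}$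 and $L_1,\dots,L_k$ form the celestial configuration $m\#(a_1,b_1;\dots;a_k,b_k)$: each ring consists of $m$ distinct elements; the $n$-th line of $L_j$ contains the four distinct points with indices $n,\,n+a_j$ in $P_{j-1}$ and $n,\,n+b_j$ in $P_j$ (where $P_k=P_0$); dually, the four lines that this prescribes through each point, namely those with indices $n,\,n-b_j$ in $L_j$ and $n,\,n-a_{j+1}$ in $L_{j+1}$ (where $L_{k+1}=L_1$, $a_{k+1}=a_1$) through the $n$-th point of $P_j$, are distinct. (Coincidences between elements of different rings, and hence further incidences, are not excluded.) (3) This configuration is movable: there is a continuous family, parametrized by $t\in[0,1]$, of configurations over $\mathbb{K}$ with all the properties in (2) for the same symbol, which starts with the given one at $t=0$, keeps four of its points in general position (no three collinear) fixed, and moves some other point; in particular the motion is not induced by projective transformations. -/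

import Mathlib

open scoped LinearAlgebra.Projectivization

namespace Poncelet

/-- The projective plane over `K`. A line is also given by its homogeneous coordinates, so that a
point `p` lies on a line `l` iff `p.orthogonal l`; the join of two distinct points and the meet of
two distinct lines are both `Projectivization.cross`. -/
abbrev Plane (K : Type*) [Field K] := ℙ K (Fin 3 → K)

section Conics

variable {K : Type*} [Field K]

/-- `A` is the matrix of a (nondegenerate) conic. -/
def IsConic (A : Matrix (Fin 3) (Fin 3) K) : Prop := A.IsSymm ∧ A.det ≠ 0

/-- The point `p` lies on the conic `A`. -/
def OnConic (A : Matrix (Fin 3) (Fin 3) K) (p : Plane K) : Prop :=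
  p.rep ⬝ᵥ A.mulVec p.rep = 0

/-- The line `l` is the tangent to the conic `A` at some point `q` of `A`. -/
def IsTangent (A : Matrix (Fin 3) (Fin 3) K) (l : Plane K) : Prop :=
  ∃ q : Plane K, OnConic A q ∧ ∃ c : K, c ≠ 0 ∧ A.mulVec q.rep = c • l.rep

end Conics

section Rings

variable {K : Type*} [Field K] {m k : ℕ}

open Classical in
/-- The ring of lines `p_n ∨ p_{n+i}`. -/
noncomputable def joins (i : ℕ) (P : ZMod m → Plane K) : ZMod m → Plane K :=
  fun n => (P n).cross (P (n + (i : ZMod m)))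

open Classical in
/-- The ring of points `l_n ∧ l_{n-i}`. -/
noncomputable def meets (i : ℕ) (L : ZMod m → Plane K) : ZMod m → Plane K :=
  fun n => (L n).cross (L (n - (i : ZMod m)))

/-- A Poncelet `m`-gon: `m` distinct points (indexed cyclically) on a conic such that each line
joining two consecutive points is tangent to a second conic. -/
def IsPonceletPolygon (P : ZMod m → Plane K) : Prop :=
  3 ≤ m ∧ Function.Injective P ∧
    ∃ C X : Matrix (Fin 3) (Fin 3) K, IsConic C ∧ IsConic X ∧
      (∀ n, OnConic C (P n)) ∧ ∀ n, IsTangent X (joins 1 P n)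

/-- The symbol `m#(a₀,b₀;…;a_{k-1},b_{k-1})` is that of a trivial celestial configuration. Indices
are taken modulo `k` (addition in `Fin k` is cyclic). -/
structure IsTrivialCelestialSymbol [NeZero k] (m : ℕ) (a b : Fin k → ℕ) : Prop where
  a_pos : ∀ j, 0 < a j
  b_pos : ∀ j, 0 < b j
  a_lt : ∀ j, 2 * a j < m
  b_lt : ∀ j, 2 * b j < m
  a_ne_b : ∀ j, a j ≠ b j
  b_ne_a : ∀ j, b j ≠ a (j + 1)
  multiset_eq : Finset.univ.val.map a = Finset.univ.val.map b

/-- The successive point rings of the construction with symbol `m#(a₀,b₀;…;a_{k-1},b_{k-1})`: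
`P₀ = P` and `P_{n+1}` consists of the points `meets b_n (joins a_n P_n)`, with the indices of the
letters taken modulo `k`. In particular the `k`-th ring is the last one of the construction. -/
noncomputable def pointRing [NeZero k] (a b : Fin k → ℕ) (P : ZMod m → Plane K) :
    ℕ → ZMod m → Plane K
  | 0 => P
  | n + 1 => meets (b (Fin.ofNat k n)) (joins (a (Fin.ofNat k n)) (pointRing a b P n))

/-- The line rings of the construction: the `n`-th one joins points of the `n`-th point ring. -/
noncomputable def lineRing [NeZero k] (a b : Fin k → ℕ) (P : ZMod m → Plane K) (n : ℕ) :
    ZMod m → Plane K :=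
  joins (a (Fin.ofNat k n)) (pointRing a b P n)

/-- `k` rings `P₀,…,P_{k-1}` of `m` distinct points and `k` rings `L₀,…,L_{k-1}` of `m` distinct
lines with the incidences prescribed by the (cyclically closed) symbol
`m#(a₀,b₀;…;a_{k-1},b_{k-1})`: each line of `L_j` passes through two points of `P_j` with index
shift `a_j` and through two points of `P_{j+1}` with index shift `b_j`, and these four points are
distinct; dually, the four lines that this prescribes through each point are distinct. -/
structure IsCelestialConfiguration [NeZero k] (a b : Fin k → ℕ)
    (P L : Fin k → ZMod m → Plane K) : Prop where
  point_injective : ∀ j, Function.Injective (P j)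
  line_injective : ∀ j, Function.Injective (L j)
  mem₁ : ∀ j n, (P j n).orthogonal (L j n)
  mem₂ : ∀ j n, (P j (n + (a j : ZMod m))).orthogonal (L j n)
  mem₃ : ∀ j n, (P (j + 1) n).orthogonal (L j n)
  mem₄ : ∀ j n, (P (j + 1) (n + (b j : ZMod m))).orthogonal (L j n)
  four_points : ∀ j n,
    [P j n, P j (n + (a j : ZMod m)), P (j + 1) n, P (j + 1) (n + (b j : ZMod m))].Nodup
  four_lines : ∀ j n,
    [L j n, L j (n - (b j : ZMod m)), L (j + 1) n, L (j + 1) (n - (a (j + 1) : ZMod m))].Nodup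

end Rings

section Motion

variable {𝕜 : Type*} [RCLike 𝕜] {m k : ℕ}

/-- A path in the projective plane is continuous: it has continuous homogeneous coordinates. -/
def IsContinuousPath (γ : unitInterval → Plane 𝕜) : Prop :=
  ∃ v : unitInterval → Fin 3 → 𝕜, Continuous v ∧
    ∀ t, ∃ h : v t ≠ 0, γ t = Projectivization.mk 𝕜 (v t) h

/-- Four points are in general position: no three of them are collinear. -/
def InGeneralPosition (q : Fin 4 → Plane 𝕜) : Prop :=
  ∀ s : Fin 4, Projectivization.Independent (fun r : Fin 3 => q (s.succAbove r))

/-- A celestial configuration is movable if it admits a motion, that is a continuous family of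
configurations with the same symbol starting with the given one, which is not induced by projective
transformations: four points in general position stay fixed, while some other point moves. -/
def IsMovable [NeZero k] (a b : Fin k → ℕ) (P L : Fin k → ZMod m → Plane 𝕜) : Prop :=
  ∃ X Y : unitInterval → Fin k → ZMod m → Plane 𝕜,
    (∀ j n, IsContinuousPath (fun t => X t j n)) ∧
    (∀ j n, IsContinuousPath (fun t => Y t j n)) ∧
    (∀ t, IsCelestialConfiguration a b (X t) (Y t)) ∧
    X 0 = P ∧ Y 0 = L ∧
    (∃ q : Fin 4 → Fin k × ZMod m,
      InGeneralPosition (fun s => P (q s).1 (q s).2) ∧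
      ∀ s t, X t (q s).1 (q s).2 = P (q s).1 (q s).2) ∧
    ∃ t j n, X t j n ≠ P j n

end Motion

end Poncelet

/-!
Over an algebraically closed field, coordinates are chosen in which the conic of the vertices is
`v₁² = v₀ v₂`, with the points `veronese x`. The second conic, as a matrix, has a square root `T`
relative to the first one (`exists_conic_sqrt`); the inverse of `T` maps the sides of the polygon to
further points of the first conic, which interpolate the vertices. In the resulting *half-step
sequence* `x : ℤ → F`, whose even terms are the vertices, neighbours satisfy a fixed symmetric
biquadratic equation. By the addition theorem on the associated cubic curve, or by solving a linear
recursion if the curve degenerates, there are commuting *chord operators*: for each `j`, one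
symmetric matrix `S j` maps every point `x k` to the chord through `x (k + j)` and `x (k - j)`
(`IsPonceletPolygon.exists_halfStep`).

Hence joining points at distance `i` and intersecting lines at distance `i` both amount to applying
a fixed projective transformation to the half-step sequence, and shifting it: each ring of points is
the image of the sequence under a product of factors `(S a)⁻¹ * S b`
(`pointRing_eq_conicPoint`). These factors commute, so that they cancel, as do the shifts, when the
letters `a` and `b` form the same multiset. The incidence statements reduce to the distinctness of
terms of the sequence. All of this descends to a subfield, since joins and meets commute with the
extension of scalars (`pointRing_self_and_isCelestialConfiguration`).

For movability it now suffices to move the Poncelet polygon. Its vertices with parameters `x n` and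
the dual `Ψ` of the second conic satisfy one tangency equation for each side. The linearized
equations are a cyclic first order recursion for the variations of the vertices, with a single
obstruction, which is linear in the variation of `Ψ` and does not vanish identically: it takes the
value `m` at a form constructed from `Ψ` (`IsCircumscribed.exists_obstruction`). Products of pencils
at the vertices serve to show that the tangency equations remain independent when four suitable
consecutive vertices are fixed, and that another vertex can still vary
(`IsCircumscribed.exists_variation`). The implicit function theorem then gives a path of Poncelet
polygons (`IsCircumscribed.exists_motion`), and the first part applies to each of them.
-/

namespace Poncelet

/-! ### Chord operators from the addition theorem of a cubic curve -/

section ChordOperators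

variable {F : Type*} [Field F]

/-- The point with parameter `x` on the standard conic `v₁² = v₀ v₂`; the only other point of this
conic is `![0, 0, 1]`. -/
def veronese (x : F) : Fin 3 → F := ![1, x, x ^ 2]

/-- The line joining the points with parameters `x` and `y` of the standard conic; for `x = y` it
is the tangent. -/
def chord (x y : F) : Fin 3 → F := ![x * y, -(x + y), 1]

/-- The matrix of the standard conic `v₁² = v₀ v₂`, up to a factor `2`. -/
def stdConic : Matrix (Fin 3) (Fin 3) F := !![0, 0, -1; 0, 2, 0; -1, 0, 0]

/-- The inverse of `stdConic`, that is the matrix of the dual conic. -/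
def stdConicInv : Matrix (Fin 3) (Fin 3) F := !![0, 0, -1; 0, 1 / 2, 0; -1, 0, 0]

/-- The sequence of points with parameters `x k` on the standard conic has *chord operators*: for
every `j` one symmetric matrix `S j` maps each point of the sequence to the chord joining its two
neighbours at distance `j`, and the operators `stdConicInv * S j` commute with each other. -/
def HasChordOperators (x : ℤ → F) : Prop :=
  ∃ S : ℕ → Matrix (Fin 3) (Fin 3) F, (∀ j, (S j).IsSymm) ∧
    (∀ i j, S i * stdConicInv * S j = S j * stdConicInv * S i) ∧
    ∀ (j : ℕ) (k : ℤ), ∃ c : F, c ≠ 0 ∧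
      (S j).mulVec (veronese (x k)) = c • chord (x (k + j)) (x (k - j))

lemma stdConic_mulVec_veronese (x : F) :
    stdConic.mulVec (veronese x) = (-1 : F) • chord x x := by
  ext i; fin_cases i <;> simp [stdConic, veronese, chord, Matrix.mulVec, dotProduct,
    Fin.sum_univ_three] <;> ring

lemma stdConic_isSymm : (stdConic : Matrix (Fin 3) (Fin 3) F).IsSymm := by
  ext i j; fin_cases i <;> fin_cases j <;> simp [stdConic]

/-- On the curve `Y² = X³ + a X² + b X + c`, the abscissas of `Q + T` and `Q - T` are the roots of a
quadratic polynomial, whose coefficients are quadratic polynomials in the abscissa of `Q`. The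
coefficients of the latter, which depend on the abscissa `ξ` of `T` only, are the entries of this
symmetric matrix. -/
def ellipticChordOperator (a b c ξ : F) : Matrix (Fin 3) (Fin 3) F :=
  !![b ^ 2 - 4 * c * ξ - 4 * c * a, -(2 * b * ξ + 4 * c), ξ ^ 2;
    -(2 * b * ξ + 4 * c), -(2 * b + 2 * ξ ^ 2 + 4 * a * ξ), -(2 * ξ);
    ξ ^ 2, -(2 * ξ), 1]

lemma ellipticChordOperator_isSymm (a b c ξ : F) : (ellipticChordOperator a b c ξ).IsSymm := by
  ext i j; fin_cases i <;> fin_cases j <;> simp [ellipticChordOperator]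

lemma stdConicInv_mul_stdConic [CharZero F] :
    (stdConicInv * stdConic : Matrix (Fin 3) (Fin 3) F) = 1 := by
  ext i j; fin_cases i <;> fin_cases j <;>
    simp [stdConicInv, stdConic, Matrix.mul_apply, Fin.sum_univ_three]

lemma stdConic_mul_stdConicInv [CharZero F] :
    (stdConic * stdConicInv : Matrix (Fin 3) (Fin 3) F) = 1 := by
  ext i j; fin_cases i <;> fin_cases j <;>
    simp [stdConicInv, stdConic, Matrix.mul_apply, Fin.sum_univ_three]

lemma ellipticChordOperator_comm [CharZero F] (a b c ξ ξ' : F) :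
    ellipticChordOperator a b c ξ * stdConicInv * ellipticChordOperator a b c ξ' =
      ellipticChordOperator a b c ξ' * stdConicInv * ellipticChordOperator a b c ξ := by
  ext i j; fin_cases i <;> fin_cases j <;>
    simp [ellipticChordOperator, stdConicInv, Matrix.mul_apply, Fin.sum_univ_three] <;> ring

/-- The curve `Y² = X³ + a X² + b X + c`. It may be singular. -/
def cubicCurve (a b c : F) : WeierstrassCurve.Affine F :=
  { a₁ := 0, a₂ := a, a₃ := 0, a₄ := b, a₆ := c }

lemma cubicCurve_equation (a b c x y : F) :
    (cubicCurve a b c).Equation x y ↔ y ^ 2 = x ^ 3 + a * x ^ 2 + b * x + c := by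
  rw [WeierstrassCurve.Affine.equation_iff]
  simp [cubicCurve]

lemma cubicCurve_nonsingular [CharZero F] {a b c x y : F}
    (h : y ^ 2 = x ^ 3 + a * x ^ 2 + b * x + c) (hy : y ≠ 0) :
    (cubicCurve a b c).Nonsingular x y := by
  rw [WeierstrassCurve.Affine.nonsingular_iff, cubicCurve_equation]
  refine ⟨h, Or.inr ?_⟩
  simp only [cubicCurve, zero_mul, sub_zero]
  intro h'
  apply hy
  have : 2 * y = 0 := by linear_combination h'
  simpa using this

open WeierstrassCurve.Affine in
lemma ellipticChordOperator_mulVec [DecidableEq F] {a b c x y ξ η x₁ y₁ x₂ y₂ : F}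
    {hQ : (cubicCurve a b c).Nonsingular x y} {hT : (cubicCurve a b c).Nonsingular ξ η}
    {h₁ : (cubicCurve a b c).Nonsingular x₁ y₁} {h₂ : (cubicCurve a b c).Nonsingular x₂ y₂}
    (hx : x ≠ ξ) (hadd : Point.some x y hQ + Point.some ξ η hT = Point.some x₁ y₁ h₁)
    (hsub : Point.some x y hQ - Point.some ξ η hT = Point.some x₂ y₂ h₂) :
    (ellipticChordOperator a b c ξ).mulVec (veronese x) = (x - ξ) ^ 2 • chord x₁ x₂ := by
  have e1 := (cubicCurve_equation ..).1 hQ.1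
  have e2 := (cubicCurve_equation ..).1 hT.1
  rw [sub_eq_add_neg, Point.neg_some, Point.add_of_X_ne hx, Point.some.injEq] at hsub
  rw [Point.add_of_X_ne hx, Point.some.injEq] at hadd
  have h1 := hadd.1
  have h2 := hsub.1
  rw [slope_of_X_ne hx] at h1 h2
  have hx' : x - ξ ≠ 0 := sub_ne_zero.2 hx
  simp only [addX, negY, cubicCurve, zero_mul, add_zero, sub_zero] at h1 h2
  have h1' : (x - ξ) ^ 2 * x₁ = (y - η) ^ 2 - (a + x + ξ) * (x - ξ) ^ 2 := by
    rw [← h1]; field_simp; ring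
  have h2' : (x - ξ) ^ 2 * x₂ = (y + η) ^ 2 - (a + x + ξ) * (x - ξ) ^ 2 := by
    rw [← h2]; field_simp; ring
  have hsum : (x - ξ) ^ 2 * (x₁ + x₂) = 2 * (x + ξ) * (x * ξ + b) + 4 * a * x * ξ + 4 * c := by
    linear_combination h1' + h2' + 2 * e1 + 2 * e2
  have hprod : (x - ξ) ^ 2 * (x₁ * x₂) = (x * ξ - b) ^ 2 - 4 * c * (x + ξ + a) := by
    have : (x - ξ) ^ 2 * ((x - ξ) ^ 2 * (x₁ * x₂)) =
        (x - ξ) ^ 2 * ((x * ξ - b) ^ 2 - 4 * c * (x + ξ + a)) := by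
      have e3 : (y ^ 2 - η ^ 2) ^ 2 =
          (x ^ 3 + a * x ^ 2 + b * x - (ξ ^ 3 + a * ξ ^ 2 + b * ξ)) ^ 2 := by
        rw [e1, e2]; ring
      calc _ = ((x - ξ) ^ 2 * x₁) * ((x - ξ) ^ 2 * x₂) := by ring
        _ = (y ^ 2 - η ^ 2) ^ 2 - 2 * (y ^ 2 + η ^ 2) * ((a + x + ξ) * (x - ξ) ^ 2)
            + ((a + x + ξ) * (x - ξ) ^ 2) ^ 2 := by rw [h1', h2']; ring
        _ = _ := by rw [e3, e1, e2]; ring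
    exact mul_left_cancel₀ (pow_ne_zero 2 hx') this
  ext i
  fin_cases i
  · simp [ellipticChordOperator, veronese, chord, Matrix.mulVec, dotProduct, Fin.sum_univ_three]
    linear_combination -hprod
  · simp [ellipticChordOperator, veronese, chord, Matrix.mulVec, dotProduct, Fin.sum_univ_three]
    linear_combination hsum
  · simp [ellipticChordOperator, veronese, chord, Matrix.mulVec, dotProduct, Fin.sum_univ_three]
    ring

/-- The chord operator of the translation by a point of the curve. -/
def pointChordOperator {a b c : F} :
    (cubicCurve a b c).Point → Matrix (Fin 3) (Fin 3) F
  | .zero => stdConic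
  | .some ξ _ _ => ellipticChordOperator a b c ξ

lemma pointChordOperator_isSymm {a b c : F} (T : (cubicCurve a b c).Point) :
    (pointChordOperator T).IsSymm := by
  rcases T with _ | ⟨ξ, η, h⟩
  · exact stdConic_isSymm
  · exact ellipticChordOperator_isSymm ..

lemma pointChordOperator_comm [CharZero F] {a b c : F} (T T' : (cubicCurve a b c).Point) :
    pointChordOperator T * stdConicInv * pointChordOperator T' =
      pointChordOperator T' * stdConicInv * pointChordOperator T := by
  rcases T with _ | ⟨ξ, η, h⟩ <;> rcases T' with _ | ⟨ξ', η', h'⟩ <;>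
    simp only [pointChordOperator]
  · rw [stdConic_mul_stdConicInv, mul_assoc, stdConicInv_mul_stdConic, one_mul, mul_one]
  · rw [stdConic_mul_stdConicInv, mul_assoc, stdConicInv_mul_stdConic, one_mul, mul_one]
  · exact ellipticChordOperator_comm ..

open WeierstrassCurve.Affine in
/-- Neighbours in the sequence are related by the translation by `(0, r)` on the curve
`Y² = X³ + a X² + b X + r²`, so that the addition theorem provides the chord operators. -/
theorem hasChordOperators_of_elliptic [CharZero F] {a b r : F} (hr : r ≠ 0) {x : ℤ → F}
    (h0 : ∀ k, x k ≠ 0) (hne : ∀ k, x (k + 1) ≠ x (k - 1))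
    (hsum : ∀ k, x k ^ 2 * (x (k + 1) + x (k - 1)) = 2 * b * x k + 4 * r ^ 2)
    (hprod : ∀ k, x k ^ 2 * (x (k + 1) * x (k - 1)) =
      b ^ 2 - 4 * r ^ 2 * a - 4 * r ^ 2 * x k) :
    HasChordOperators x := by
  classical
  obtain ⟨y, h4y⟩ : ∃ y : ℤ → F, ∀ k, 4 * r * y k = x k ^ 2 * (x (k - 1) - x (k + 1)) :=
    ⟨fun k => x k ^ 2 * (x (k - 1) - x (k + 1)) / (4 * r), fun k => by field_simp⟩
  have hy0 : ∀ k, y k ≠ 0 := fun k hk => by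
    have := h4y k
    rw [hk, mul_zero] at this
    exact mul_ne_zero (pow_ne_zero 2 (h0 k)) (sub_ne_zero.2 (hne k).symm) this.symm
  have hcurve : ∀ k, y k ^ 2 = x k ^ 3 + a * x k ^ 2 + b * x k + r ^ 2 := fun k => by
    have : (16 * r ^ 2) * y k ^ 2 =
        (16 * r ^ 2) * (x k ^ 3 + a * x k ^ 2 + b * x k + r ^ 2) := by
      calc _ = (4 * r * y k) ^ 2 := by ring
        _ = (x k ^ 2 * (x (k + 1) + x (k - 1))) ^ 2
            - 4 * x k ^ 2 * (x k ^ 2 * (x (k + 1) * x (k - 1))) := by rw [h4y]; ring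
        _ = _ := by rw [hsum, hprod]; ring
    exact mul_left_cancel₀ (mul_ne_zero (by norm_num) (pow_ne_zero 2 hr)) this
  have hns : ∀ k, (cubicCurve a b (r ^ 2)).Nonsingular (x k) (y k) := fun k =>
    cubicCurve_nonsingular (hcurve k) (hy0 k)
  have hRns : (cubicCurve a b (r ^ 2)).Nonsingular 0 r := cubicCurve_nonsingular (by ring) hr
  let Q : ℤ → (cubicCurve a b (r ^ 2)).Point := fun k => Point.some _ _ (hns k)
  let R : (cubicCurve a b (r ^ 2)).Point := Point.some _ _ hRns
  have hstep : ∀ k, Q (k + 1) = Q k + R := fun k => by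
    have h1 := h4y k
    have h2 := h4y (k + 1)
    have h3 := hsum k
    have h4 := hsum (k + 1)
    have hx0 := h0 k
    rw [show k + 1 - 1 = k by ring] at h2 h4
    have hA : x k ^ 2 * x (k + 1) = b * x k + 2 * r ^ 2 - 2 * r * y k := by
      have : 2 * (x k ^ 2 * x (k + 1)) = 2 * (b * x k + 2 * r ^ 2 - 2 * r * y k) := by
        linear_combination h3 + h1
      exact mul_left_cancel₀ two_ne_zero this
    have hB : 2 * r * y (k + 1) = x (k + 1) ^ 2 * x k - b * x (k + 1) - 2 * r ^ 2 := by
      have : 2 * (2 * r * y (k + 1)) =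
          2 * (x (k + 1) ^ 2 * x k - b * x (k + 1) - 2 * r ^ 2) := by
        linear_combination h2 - h4
      exact mul_left_cancel₀ two_ne_zero this
    simp only [Q, R]
    rw [Point.add_of_X_ne hx0, Point.some.injEq]
    rw [slope_of_X_ne hx0]
    have hX : (cubicCurve a b (r ^ 2)).addX (x k) 0 ((y k - r) / (x k - 0)) = x (k + 1) := by
      simp only [addX, cubicCurve, zero_mul, add_zero, sub_zero]
      have hc := hcurve k
      have : x k ^ 2 * (((y k - r) / x k) ^ 2 - a - x k) = x k ^ 2 * x (k + 1) := by
        rw [hA]; field_simp; linear_combination hc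
      exact mul_left_cancel₀ (pow_ne_zero 2 hx0) this
    refine ⟨hX.symm, ?_⟩
    rw [addY, negAddY, hX]
    simp only [negY, cubicCurve, zero_mul, sub_zero]
    have : (2 * r * x k) * y (k + 1) =
        (2 * r * x k) * -((y k - r) / x k * (x (k + 1) - x k) + y k) := by
      have hl : (y k - r) / x k * x k = y k - r := div_mul_cancel₀ _ hx0
      linear_combination x k * hB + x (k + 1) * hA + 2 * r * (x (k + 1) - x k) * hl
    exact mul_left_cancel₀ (mul_ne_zero (mul_ne_zero two_ne_zero hr) hx0) this
  have hadd : ∀ (j : ℕ) k, Q (k + j) = Q k + j • R := fun j => by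
    induction j with
    | zero => intro k; simp
    | succ j ih =>
      intro k
      rw [show k + ((j + 1 : ℕ) : ℤ) = (k + j) + 1 by push_cast; ring, hstep, ih, succ_nsmul,
        add_assoc]
  have hsub : ∀ (j : ℕ) k, Q (k - j) = Q k - j • R := fun j k => by
    rw [eq_sub_iff_add_eq, ← hadd, sub_add_cancel]
  refine ⟨fun j => pointChordOperator (j • R), fun j => pointChordOperator_isSymm _,
    fun i j => pointChordOperator_comm _ _, fun j k => ?_⟩
  have h1 := hadd j k
  have h2 := hsub j k
  beta_reduce
  generalize j • R = T at h1 h2 ⊢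
  rcases T with _ | ⟨ξ, η, h⟩
  · replace h1 : Q (k + j) = Q k := h1.trans (add_zero _)
    replace h2 : Q (k - j) = Q k := h2.trans (sub_zero _)
    simp only [Q, Point.some.injEq] at h1 h2
    refine ⟨-1, by norm_num, ?_⟩
    rw [h1.1, h2.1]
    exact stdConic_mulVec_veronese _
  · have hne' : x k ≠ ξ := by
      intro he
      rcases (Point.X_eq_iff (h₁ := hns k) (h₂ := h)).1 he with he' | he'
      · change Q k = _ at he'
        rw [he', sub_self] at h2
        exact Point.some_ne_zero _ h2
      · change Q k = _ at he'
        rw [he', neg_add_cancel] at h1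
        exact Point.some_ne_zero _ h1
    exact ⟨(x k - ξ) ^ 2, pow_ne_zero 2 (sub_ne_zero.2 hne'),
      ellipticChordOperator_mulVec hne' h1.symm h2.symm⟩

end ChordOperators

/-! ### Chord operators for symmetric biquadratic recursions -/

section NormalForms

variable {F : Type*} [Field F]

/-- A translation of the parameter is induced by a projective transformation preserving the
standard conic, and thus preserves the existence of chord operators. -/
lemma HasChordOperators.translate [CharZero F] {x z : ℤ → F} (σ : F) (hx : ∀ k, x k = z k + σ)
    (hz : HasChordOperators z) : HasChordOperators x := by
  obtain ⟨S, hsymm, hcomm, hS⟩ := hz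
  set U : Matrix (Fin 3) (Fin 3) F := !![1, 0, 0; -σ, 1, 0; σ ^ 2, -2 * σ, 1] with hU
  have hUJ : U * stdConicInv * U.transpose = stdConicInv := by
    ext i j
    fin_cases i <;> fin_cases j <;>
      simp [hU, stdConicInv, Matrix.mul_apply, Fin.sum_univ_three] <;> ring
  have hUv : ∀ y, U.mulVec (veronese (y + σ)) = veronese y := fun y => by
    ext i
    fin_cases i <;> simp [hU, veronese, Matrix.mulVec, dotProduct, Fin.sum_univ_three] <;> ring
  have hUc : ∀ y y', U.transpose.mulVec (chord y y') = chord (y + σ) (y' + σ) := fun y y' => by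
    ext i
    fin_cases i <;> simp [hU, chord, Matrix.mulVec, dotProduct, Fin.sum_univ_three] <;> ring
  refine ⟨fun j => U.transpose * S j * U, fun j => ?_, fun i j => ?_, fun j k => ?_⟩
  · beta_reduce
    rw [Matrix.IsSymm, Matrix.transpose_mul, Matrix.transpose_mul, (hsymm j).eq,
      Matrix.transpose_transpose, mul_assoc]
  · calc _ = U.transpose * (S i * (U * stdConicInv * U.transpose) * S j) * U := by
          simp only [mul_assoc]
      _ = U.transpose * (S j * (U * stdConicInv * U.transpose) * S i) * U := by
          rw [hUJ, hcomm]
      _ = _ := by simp only [mul_assoc]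
  · obtain ⟨c, hc, h⟩ := hS j k
    refine ⟨c, hc, ?_⟩
    rw [← Matrix.mulVec_mulVec, ← Matrix.mulVec_mulVec, hx, hUv, h, Matrix.mulVec_smul, hUc,
      ← hx, ← hx]

/-- The chord operators for a sequence satisfying a linear recursion. -/
lemma hasChordOperators_of_quadratic [CharZero F] {x : ℤ → F} (t s d : ℕ → F)
    (hts : ∀ i j, s i * (t j - 2) = s j * (t i - 2))
    (hsum : ∀ (j : ℕ) k, x (k + j) + x (k - j) = t j * x k + s j)
    (hprod : ∀ (j : ℕ) k, x (k + j) * x (k - j) = x k ^ 2 - s j * x k + d j) :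
    HasChordOperators x := by
  refine ⟨fun j => !![d j, -s j, 1; -s j, -t j, 0; 1, 0, 0], fun j => ?_, fun i j => ?_,
    fun j k => ⟨1, one_ne_zero, ?_⟩⟩
  · ext a b; fin_cases a <;> fin_cases b <;> simp
  · ext a b
    fin_cases a <;> fin_cases b <;>
      simp [stdConicInv, Matrix.mul_apply, Fin.sum_univ_three]
    · ring
    · linear_combination (1 / 2) * hts i j
    · linear_combination (-1 / 2) * hts i j
    · ring
  · ext a
    fin_cases a <;> simp [chord, veronese, Matrix.mulVec, dotProduct, Fin.sum_univ_three]
    · linear_combination -hprod j k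
    · linear_combination hsum j k

lemma hasChordOperators_of_linear_of_ne_two [CharZero F] {x : ℤ → F} {t δ : F}
    (hsum : ∀ k, x (k + 1) + x (k - 1) = t * x k)
    (hprod : ∀ k, x (k + 1) * x (k - 1) = x k ^ 2 + δ) :
    HasChordOperators x := by
  have key : ∀ j : ℕ, ∃ p q : F, p ^ 2 + q ^ 2 - t * p * q = 1 ∧
      ∀ k, x (k + j) = p * x (k + 1) - q * x k ∧ x (k - j) = p * x (k - 1) - q * x k := by
    intro j
    induction j with
    | zero => exact ⟨0, -1, by ring, fun k => by simp⟩
    | succ j ih =>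
      obtain ⟨p, q, hpq, h⟩ := ih
      refine ⟨t * p - q, p, by linear_combination hpq, fun k => ⟨?_, ?_⟩⟩
      · have h1 := (h (k + 1)).1
        have h2 := hsum (k + 1)
        rw [add_sub_cancel_right] at h2
        rw [show k + ((j + 1 : ℕ) : ℤ) = k + 1 + j by push_cast; ring, h1]
        linear_combination p * h2
      · have h1 := (h (k - 1)).2
        have h2 := hsum (k - 1)
        rw [sub_add_cancel] at h2
        rw [show k - ((j + 1 : ℕ) : ℤ) = k - 1 - j by push_cast; ring, h1]
        linear_combination p * h2
  choose p q hpq h using key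
  refine hasChordOperators_of_quadratic (fun j => p j * t - 2 * q j) (fun _ => 0)
    (fun j => p j ^ 2 * δ) (by simp) (fun j k => ?_) (fun j k => ?_)
  · rw [(h j k).1, (h j k).2]
    linear_combination p j * hsum k
  · rw [(h j k).1, (h j k).2]
    linear_combination p j ^ 2 * hprod k - p j * q j * x k * hsum k + x k ^ 2 * hpq j

lemma hasChordOperators_of_linear_two [CharZero F] {x : ℤ → F} {s δ : F}
    (hsum : ∀ k, x (k + 1) + x (k - 1) = 2 * x k + s)
    (hprod : ∀ k, x (k + 1) * x (k - 1) = x k ^ 2 - s * x k + δ) :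
    HasChordOperators x := by
  have key : ∀ (j : ℕ) k,
      x (k + j) = x k + j * ((x (k + 1) - x (k - 1)) / 2) + s * j ^ 2 / 2 ∧
      x (k - j) = x k - j * ((x (k + 1) - x (k - 1)) / 2) + s * j ^ 2 / 2 := by
    intro j
    induction j with
    | zero => intro k; simp
    | succ j ih =>
      intro k
      constructor
      · have h1 := (ih (k + 1)).1
        have h2 := hsum (k + 1)
        have h3 := hsum k
        rw [add_sub_cancel_right] at h1 h2
        rw [show k + ((j + 1 : ℕ) : ℤ) = k + 1 + j by push_cast; ring, h1]
        push_cast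
        linear_combination (j / 2 : F) * h2 + (1 / 2 + j / 2 : F) * h3
      · have h1 := (ih (k - 1)).2
        have h2 := hsum (k - 1)
        have h3 := hsum k
        rw [sub_add_cancel] at h1 h2
        rw [show k - ((j + 1 : ℕ) : ℤ) = k - 1 - j by push_cast; ring, h1]
        push_cast
        linear_combination (j / 2 : F) * h2 + (1 / 2 + j / 2 : F) * h3
  refine hasChordOperators_of_quadratic (fun _ => 2) (fun j => s * j ^ 2)
    (fun j => j ^ 2 * δ + s ^ 2 * j ^ 2 * (j ^ 2 - 1) / 4) (by simp)
    (fun j k => ?_) (fun j k => ?_)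
  · rw [(key j k).1, (key j k).2]
    ring
  · rw [(key j k).1, (key j k).2]
    linear_combination (j ^ 2 : F) * hprod k
      - (j ^ 2 / 4 : F) * (x (k + 1) + x (k - 1) + 2 * x k + s) * hsum k

/-- A sequence whose neighbours are related by a nondegenerate symmetric biquadratic form `T` has
chord operators. The assumption on the entry `(2, 2)` means that the common point `![0, 0, 1]`
of the standard conic and of the conic `T * stdConicInv * T` has been moved to infinity; the last
one says that `T` fixes this point if `T * stdConicInv * T` does. -/
theorem hasChordOperators_of_biquadratic [CharZero F] [IsAlgClosed F]
    {T : Matrix (Fin 3) (Fin 3) F} (hT : T.IsSymm) (hdet : T.det ≠ 0) {x : ℤ → F}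
    (hx : ∀ k, veronese (x k) ⬝ᵥ T.mulVec (veronese (x (k + 1))) = 0)
    (hne : ∀ k, x (k + 1) ≠ x (k - 1))
    (h22 : (T * stdConicInv * T : Matrix (Fin 3) (Fin 3) F) 2 2 = 0)
    (h12 : (T * stdConicInv * T : Matrix (Fin 3) (Fin 3) F) 1 2 = 0 → T 2 2 = 0) :
    HasChordOperators x := by
  have e01 : T 1 0 = T 0 1 := hT.apply 0 1
  have e02 : T 2 0 = T 0 2 := hT.apply 0 2
  have e12 : T 2 1 = T 1 2 := hT.apply 1 2
  have hF : ∀ k, T 2 2 * (x k ^ 2 * x (k + 1) ^ 2) + T 1 2 * (x k * x (k + 1) * (x k + x (k + 1)))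
      + T 0 2 * (x k ^ 2 + x (k + 1) ^ 2) + T 1 1 * (x k * x (k + 1))
      + T 0 1 * (x k + x (k + 1)) + T 0 0 = 0 := fun k => by
    rw [← hx k]
    simp [veronese, Matrix.mulVec, dotProduct, Fin.sum_univ_three, e01, e02, e12]
    ring
  have hF' : ∀ k, T 2 2 * (x k ^ 2 * x (k - 1) ^ 2) + T 1 2 * (x k * x (k - 1) * (x k + x (k - 1)))
      + T 0 2 * (x k ^ 2 + x (k - 1) ^ 2) + T 1 1 * (x k * x (k - 1))
      + T 0 1 * (x k + x (k - 1)) + T 0 0 = 0 := fun k => by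
    have := hF (k - 1)
    rw [sub_add_cancel] at this
    linear_combination this
  have hsub : ∀ k, x (k + 1) - x (k - 1) ≠ 0 := fun k => sub_ne_zero.2 (hne k)
  have hsum : ∀ k, (T 2 2 * x k ^ 2 + T 1 2 * x k + T 0 2) * (x (k + 1) + x (k - 1)) =
      - (T 1 2 * x k ^ 2 + T 1 1 * x k + T 0 1) := fun k => by
    apply mul_left_cancel₀ (hsub k)
    linear_combination hF k - hF' k
  have hprod : ∀ k, (T 2 2 * x k ^ 2 + T 1 2 * x k + T 0 2) * (x (k + 1) * x (k - 1)) =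
      T 0 2 * x k ^ 2 + T 0 1 * x k + T 0 0 := fun k => by
    linear_combination -hF k + x (k + 1) * hsum k
  simp only [Matrix.mul_apply, Fin.sum_univ_three, stdConicInv, e01, e02, e12, Matrix.of_apply,
    Matrix.cons_val', Matrix.cons_val_zero, Matrix.cons_val_one, Matrix.cons_val,
    Matrix.cons_val_fin_one, mul_zero, add_zero, zero_add] at h22 h12
  by_cases h : T 2 2 = 0
  · have h12' : T 1 2 = 0 := by
      have : T 1 2 ^ 2 = 0 := by rw [h] at h22; linear_combination 2 * h22
      exact pow_eq_zero_iff two_ne_zero |>.1 this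
    have h02 : T 0 2 ≠ 0 := by
      intro h02
      apply hdet
      rw [Matrix.det_fin_three, e12, e02, h, h12', h02]
      ring
    have hs : ∀ k, x (k + 1) + x (k - 1) = -(T 1 1 / T 0 2) * x k + -(T 0 1 / T 0 2) := fun k => by
      have := hsum k
      rw [h, h12'] at this
      field_simp
      linear_combination this
    have hp : ∀ k, x (k + 1) * x (k - 1) =
        x k ^ 2 - -(T 0 1 / T 0 2) * x k + T 0 0 / T 0 2 := fun k => by
      have := hprod k
      rw [h, h12'] at this
      field_simp
      linear_combination this
    generalize -(T 1 1 / T 0 2) = t at hs hp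
    generalize -(T 0 1 / T 0 2) = s at hs hp
    generalize T 0 0 / T 0 2 = δ at hs hp
    by_cases ht : t = 2
    · subst ht
      exact hasChordOperators_of_linear_two hs hp
    · have ht' : 2 - t ≠ 0 := sub_ne_zero.2 (Ne.symm ht)
      have hσ : s = (2 - t) * (s / (2 - t)) := by field_simp
      generalize s / (2 - t) = σ at hσ
      refine HasChordOperators.translate (z := fun k => x k - σ) σ (fun k => by ring)
        (hasChordOperators_of_linear_of_ne_two (t := t) (δ := δ - (2 - t) * σ ^ 2) (fun k => ?_)
          (fun k => ?_))
      · linear_combination hs k + hσ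
      · linear_combination hp k - σ * hs k - (x k + σ) * hσ
  · have hα : T 2 2 ≠ 0 := h
    obtain ⟨ξ, hξ⟩ : ∃ ξ, T 1 2 = -2 * T 2 2 * ξ := ⟨-T 1 2 / (2 * T 2 2), by field_simp⟩
    have h02 : T 0 2 = T 2 2 * ξ ^ 2 := by
      apply mul_left_cancel₀ hα
      rw [hξ] at h22
      linear_combination -1 / 2 * h22
    obtain ⟨d, hd⟩ : ∃ d, T 1 1 = T 2 2 * d := ⟨T 1 1 / T 2 2, by field_simp⟩
    obtain ⟨e, he⟩ : ∃ e, T 0 1 = T 2 2 * e := ⟨T 0 1 / T 2 2, by field_simp⟩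
    obtain ⟨f, hf⟩ : ∃ f, T 0 0 = T 2 2 * f := ⟨T 0 0 / T 2 2, by field_simp⟩
    have he' : e + d * ξ - 2 * ξ ^ 3 ≠ 0 := by
      intro h0
      apply h
      apply h12
      rw [hξ, h02, hd, he]
      linear_combination -T 2 2 ^ 2 * h0
    obtain ⟨r, hr⟩ := IsAlgClosed.exists_pow_nat_eq (-(e + d * ξ - 2 * ξ ^ 3) / 4) two_pos
    have hr0 : r ≠ 0 := by
      rintro rfl
      apply he'
      linear_combination 4 * hr
    have hs : ∀ k, (x k - ξ) ^ 2 * (x (k + 1) + x (k - 1)) =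
        2 * ξ * x k ^ 2 - d * x k - e := fun k => by
      apply mul_left_cancel₀ hα
      have := hsum k
      rw [hξ, h02, hd, he] at this
      linear_combination this
    have hp : ∀ k, (x k - ξ) ^ 2 * (x (k + 1) * x (k - 1)) =
        ξ ^ 2 * x k ^ 2 + e * x k + f := fun k => by
      apply mul_left_cancel₀ hα
      have := hprod k
      rw [hξ, h02, he, hf] at this
      linear_combination this
    have hs' : ∀ k, (x k - ξ) ^ 2 * (x (k + 1) - ξ + (x (k - 1) - ξ)) =
        2 * (-(d - 4 * ξ ^ 2) / 2) * (x k - ξ) + 4 * r ^ 2 := fun k => by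
      linear_combination hs k - 4 * hr
    obtain ⟨a, ha⟩ : ∃ a, 4 * r ^ 2 * a =
        (-(d - 4 * ξ ^ 2) / 2) ^ 2 - (f + 2 * e * ξ + d * ξ ^ 2 - ξ ^ 4) :=
      ⟨((-(d - 4 * ξ ^ 2) / 2) ^ 2 - (f + 2 * e * ξ + d * ξ ^ 2 - ξ ^ 4)) / (4 * r ^ 2), by
        field_simp⟩
    refine HasChordOperators.translate (z := fun k => x k - ξ) ξ (fun k => by ring)
      (hasChordOperators_of_elliptic (r := r) (b := -(d - 4 * ξ ^ 2) / 2)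
        (a := a) hr0 (fun k hk => ?_) (fun k hk => hne k (sub_left_injective hk)) hs' (fun k => ?_))
    · have := hs' k
      rw [hk] at this
      apply hr0
      have h4 : 4 * r ^ 2 = 0 := by linear_combination -this
      simpa using h4
    · linear_combination hp k - ξ * hs k + 4 * (x k - ξ) * hr + ha

end NormalForms

/-! ### Square roots of conics -/

section SquareRoot

variable {F : Type*} [Field F]

open Polynomial in
/-- An invertible `3 × 3` matrix `A` over an algebraically closed field of characteristic zero has
a square root which is a quadratic polynomial in `A`. -/
lemma exists_quadratic_sqrt [CharZero F] [IsAlgClosed F] (A : Matrix (Fin 3) (Fin 3) F)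
    (hA : A.det ≠ 0) :
    ∃ u v w : F, (u • (1 : Matrix (Fin 3) (Fin 3) F) + v • A + w • (A * A)) *
      (u • (1 : Matrix (Fin 3) (Fin 3) F) + v • A + w • (A * A)) = A := by
  have hcard : Multiset.card A.charpoly.roots = 3 := by
    rw [← (IsAlgClosed.splits A.charpoly).natDegree_eq_card_roots, Matrix.charpoly_natDegree_eq_dim]
    simp
  obtain ⟨a, b, c, habc⟩ := Multiset.card_eq_three.1 hcard
  have hchi : A.charpoly = (X - C a) * ((X - C b) * (X - C c)) := by
    rw [(IsAlgClosed.splits A.charpoly).eq_prod_roots_of_monic A.charpoly_monic, habc]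
    simp
  have hdet : A.det = a * (b * c) := by
    rw [Matrix.det_eq_prod_roots_charpoly, habc]
    simp
  rw [hdet] at hA
  have ha : a ≠ 0 := left_ne_zero_of_mul hA
  have hb : b ≠ 0 := left_ne_zero_of_mul (right_ne_zero_of_mul hA)
  have hc : c ≠ 0 := right_ne_zero_of_mul (right_ne_zero_of_mul hA)
  choose s hs using fun z : F => IsAlgClosed.exists_pow_nat_eq z two_pos
  -- The square root is chosen as a function of the eigenvalue, so that opposite values do not occur.
  have hadd : ∀ y z : F, y ≠ 0 → s y + s z ≠ 0 := fun y z hy h => by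
    have hyz : y = z := by rw [← hs y, ← hs z, eq_neg_of_add_eq_zero_left h]; ring
    subst hyz
    have : s y = 0 := by
      have : 2 * s y = 0 := by linear_combination h
      simpa using this
    apply hy
    rw [← hs y, this]
    ring
  have hab := hadd a b ha
  have hac := hadd a c ha
  have hbc := hadd b c hb
  have e1 := hs a
  have e2 := hs b
  have e3 := hs c
  generalize s a = α at *
  generalize s b = β at *
  generalize s c = γ at *
  set D := (α + β) * (α + γ) * (β + γ) with hD
  have hD0 : D ≠ 0 := mul_ne_zero (mul_ne_zero hab hac) hbc
  set m := (α + β + γ) ^ 2 - (α * β + α * γ + β * γ) with hm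
  set n := (α + β + γ) * (α * β * γ) with hn
  have hpoly : (-X ^ 2 + C m * X + C n) ^ 2 =
      C (D ^ 2) * X + A.charpoly * (X - C ((α + β + γ) ^ 2)) := by
    rw [hchi, ← e1, ← e2, ← e3, hD, hm, hn]
    simp only [map_mul, map_add, map_sub, map_pow]
    ring
  have hmat := congrArg (aeval A) hpoly
  rw [map_add, map_mul (aeval A) A.charpoly, Matrix.aeval_self_charpoly, zero_mul, add_zero] at hmat
  simp only [map_add, map_neg, map_pow, map_mul, aeval_X, aeval_C] at hmat
  refine ⟨n / D, m / D, -1 / D, ?_⟩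
  have hM : (n / D) • (1 : Matrix (Fin 3) (Fin 3) F) + (m / D) • A + (-1 / D) • (A * A) =
      D⁻¹ • (-A ^ 2 + algebraMap F _ m * A + algebraMap F _ n) := by
    rw [Algebra.algebraMap_eq_smul_one, Algebra.algebraMap_eq_smul_one, smul_mul_assoc, one_mul,
      smul_add, smul_add, smul_neg, smul_smul, smul_smul, div_eq_inv_mul, div_eq_inv_mul,
      div_eq_inv_mul, mul_neg_one, neg_smul, pow_two]
    abel
  rw [hM, smul_mul_smul_comm, ← pow_two (-A ^ 2 + _ + _), hmat, ← map_pow,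
    Algebra.algebraMap_eq_smul_one, smul_mul_assoc, one_mul, smul_smul]
  rw [show D⁻¹ * D⁻¹ * D ^ 2 = 1 by field_simp, one_smul]

/-- A conic `X` has a square root relative to the standard conic, which belongs to the algebra
generated by `X`. -/
lemma exists_conic_sqrt [CharZero F] [IsAlgClosed F] {X : Matrix (Fin 3) (Fin 3) F}
    (hX : X.IsSymm) (hdet : X.det ≠ 0) (h22 : X 2 2 = 0) :
    ∃ T : Matrix (Fin 3) (Fin 3) F, T.IsSymm ∧ T * stdConicInv * T = X ∧
      (X 1 2 = 0 → T 2 2 = 0) := by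
  have hJ : (stdConicInv : Matrix (Fin 3) (Fin 3) F).IsSymm := by
    ext i j; fin_cases i <;> fin_cases j <;> simp [stdConicInv]
  have hJdet : (stdConicInv : Matrix (Fin 3) (Fin 3) F).det ≠ 0 := fun h => by
    have := congrArg Matrix.det (stdConicInv_mul_stdConic (F := F))
    rw [Matrix.det_mul, h] at this
    simp at this
  obtain ⟨u, v, w, h⟩ := exists_quadratic_sqrt (stdConicInv * X)
    (by rw [Matrix.det_mul]; exact mul_ne_zero hJdet hdet)
  set B := u • (1 : Matrix (Fin 3) (Fin 3) F) + v • (stdConicInv * X) +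
    w • (stdConicInv * X * (stdConicInv * X)) with hB
  have hT : stdConic * B = u • stdConic + v • X + w • (X * stdConicInv * X) := by
    have hJ' : ∀ Y : Matrix (Fin 3) (Fin 3) F, stdConic * (stdConicInv * Y) = Y := fun Y => by
      rw [← mul_assoc, stdConic_mul_stdConicInv, one_mul]
    rw [hB, mul_add, mul_add, mul_smul_comm, mul_smul_comm, mul_smul_comm, mul_one, hJ',
      mul_assoc stdConicInv X, hJ', ← mul_assoc]
  refine ⟨stdConic * B, ?_, ?_, fun h12 => ?_⟩
  · rw [hT, Matrix.IsSymm]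
    simp only [Matrix.transpose_add, Matrix.transpose_smul, Matrix.transpose_mul, hX.eq, hJ.eq,
      stdConic_isSymm.eq, mul_assoc]
  · rw [mul_assoc, mul_assoc, ← mul_assoc stdConicInv, stdConicInv_mul_stdConic, one_mul, h,
      ← mul_assoc, stdConic_mul_stdConicInv, one_mul]
  · have h21 : X 2 1 = 0 := (hX.apply 1 2).trans h12
    rw [hT]
    simp [stdConic, stdConicInv, Matrix.mul_apply, Fin.sum_univ_three, h22, h21, h12]

end SquareRoot

/-! ### Conics and projective coordinates -/

section Conics

open Matrix

variable {F : Type*} [Field F]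

lemma dotProduct_mulVec_comm {A : Matrix (Fin 3) (Fin 3) F} (hA : A.IsSymm) (v w : Fin 3 → F) :
    v ⬝ᵥ A *ᵥ w = w ⬝ᵥ A *ᵥ v := by
  rw [dotProduct_mulVec, ← mulVec_transpose, hA.eq, dotProduct_comm]

lemma mulVec_ne_zero {A : Matrix (Fin 3) (Fin 3) F} (hA : A.det ≠ 0) {v : Fin 3 → F}
    (hv : v ≠ 0) : A *ᵥ v ≠ 0 := fun h => hv (eq_zero_of_mulVec_eq_zero hA h)

lemma transpose_mulVec_cross (G : Matrix (Fin 3) (Fin 3) F) (v w : Fin 3 → F) :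
    Gᵀ *ᵥ (crossProduct (G *ᵥ v) (G *ᵥ w)) = G.det • crossProduct v w := by
  rw [det_fin_three]
  ext i
  fin_cases i <;> simp [cross_apply, mulVec, dotProduct, Fin.sum_univ_three] <;> ring

lemma dotProduct_congr_mulVec (A G : Matrix (Fin 3) (Fin 3) F) (v w : Fin 3 → F) :
    (G *ᵥ v) ⬝ᵥ A *ᵥ (G *ᵥ w) = v ⬝ᵥ (Gᵀ * A * G) *ᵥ w := by
  rw [← mulVec_mulVec, ← mulVec_mulVec, dotProduct_mulVec v, vecMul_transpose]

lemma isSymm_congr {A : Matrix (Fin 3) (Fin 3) F} (hA : A.IsSymm) (G : Matrix (Fin 3) (Fin 3) F) :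
    (Gᵀ * A * G).IsSymm := by
  rw [IsSymm, transpose_mul, transpose_mul, hA.eq, transpose_transpose, mul_assoc]

lemma det_congr_ne_zero {A G : Matrix (Fin 3) (Fin 3) F} (hA : A.det ≠ 0) (hG : G.det ≠ 0) :
    (Gᵀ * A * G).det ≠ 0 := by
  rw [det_mul, det_mul, det_transpose]
  exact mul_ne_zero (mul_ne_zero hG hA) hG

lemma det_stdConic : (stdConic : Matrix (Fin 3) (Fin 3) F).det = -2 := by
  simp [det_fin_three, stdConic]

lemma stdConic_isotropic_iff [CharZero F] {v : Fin 3 → F} :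
    v ⬝ᵥ stdConic *ᵥ v = 0 ↔ v 1 ^ 2 = v 0 * v 2 := by
  have : v ⬝ᵥ stdConic *ᵥ v = 2 * (v 1 ^ 2 - v 0 * v 2) := by
    simp [stdConic, mulVec, dotProduct, Fin.sum_univ_three]
    ring
  rw [this, mul_eq_zero, sub_eq_zero]
  simp

lemma veronese_ne_zero (x : F) : veronese x ≠ 0 := fun h => by
  have := congrFun h 0
  simp [veronese] at this

lemma chord_ne_zero (x y : F) : chord x y ≠ 0 := fun h => by
  have := congrFun h 2
  simp [chord] at this

lemma veronese_isotropic [CharZero F] (x : F) :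
    veronese x ⬝ᵥ stdConic *ᵥ veronese x = 0 := by
  rw [stdConic_isotropic_iff]
  simp [veronese]

lemma cross_veronese (x y : F) :
    crossProduct (veronese x) (veronese y) = (y - x) • chord x y := by
  ext i
  fin_cases i <;> simp [cross_apply, veronese, chord] <;> ring

lemma veronese_dotProduct_chord (x y z : F) :
    veronese z ⬝ᵥ chord x y = (z - x) * (z - y) := by
  simp [veronese, chord, dotProduct, Fin.sum_univ_three]
  ring

lemma chord_dotProduct_stdConicInv [CharZero F] (x y : F) :
    chord x y ⬝ᵥ stdConicInv *ᵥ chord x y = (x - y) ^ 2 / 2 := by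
  simp [stdConicInv, chord, mulVec, dotProduct, Fin.sum_univ_three]
  ring

/-- The point `![0, 0, 1]` is the only one of the standard conic without a parameter. -/
lemma eq_smul_veronese_or [CharZero F] {v : Fin 3 → F} (hv0 : v ≠ 0)
    (hv : v ⬝ᵥ stdConic *ᵥ v = 0) :
    (∃ c x : F, c ≠ 0 ∧ v = c • veronese x) ∨ ∃ c : F, c ≠ 0 ∧ v = c • ![0, 0, 1] := by
  rw [stdConic_isotropic_iff] at hv
  by_cases h : v 0 = 0
  · right
    have h1 : v 1 = 0 := by
      rw [h, zero_mul] at hv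
      exact pow_eq_zero_iff two_ne_zero |>.1 hv
    have he : v = v 2 • ![0, 0, 1] := by
      ext i
      fin_cases i <;> simp [h, h1]
    refine ⟨v 2, fun h2 => hv0 ?_, he⟩
    rw [he, h2, zero_smul]
  · left
    refine ⟨v 0, v 1 / v 0, h, ?_⟩
    ext i
    fin_cases i
    · simp [veronese]
    · simp [veronese]; field_simp
    · simp [veronese]; field_simp; linear_combination -hv

/-- Every conic with a point is projectively equivalent to the standard conic, and the point may be
moved to infinity. -/
lemma exists_congr_stdConic [CharZero F] {A : Matrix (Fin 3) (Fin 3) F} (hA : IsConic A)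
    {e : Fin 3 → F} (he0 : e ≠ 0) (he : e ⬝ᵥ A *ᵥ e = 0) :
    ∃ G : Matrix (Fin 3) (Fin 3) F, G.det ≠ 0 ∧ G *ᵥ ![0, 0, 1] = e ∧
      ∃ γ : F, γ ≠ 0 ∧ Gᵀ * A * G = γ • stdConic := by
  obtain ⟨hsymm, hdet⟩ := hA
  obtain ⟨u, hu⟩ : ∃ u, u ⬝ᵥ A *ᵥ e ≠ 0 := by
    by_contra! h
    exact mulVec_ne_zero hdet he0 (dotProduct_eq_zero_iff.1 fun w => by rw [dotProduct_comm, h])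
  -- A second point `w` of the conic, and the pole `g` of the line through both points.
  obtain ⟨w, hwe, hw⟩ : ∃ w, w ⬝ᵥ A *ᵥ e ≠ 0 ∧ w ⬝ᵥ A *ᵥ w = 0 := by
    refine ⟨u - ((u ⬝ᵥ A *ᵥ u) / (2 * (u ⬝ᵥ A *ᵥ e))) • e, ?_, ?_⟩
    · rwa [sub_dotProduct, smul_dotProduct, he, smul_zero, sub_zero]
    · rw [mulVec_sub, mulVec_smul, sub_dotProduct, dotProduct_sub, dotProduct_sub,
        smul_dotProduct, smul_dotProduct, dotProduct_smul, dotProduct_smul, he,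
        dotProduct_mulVec_comm hsymm e u]
      simp only [smul_eq_mul]
      field_simp
      ring
  set g := crossProduct (A *ᵥ e) (A *ᵥ w) with hg
  have hge : g ⬝ᵥ A *ᵥ e = 0 := by rw [dotProduct_comm, hg, dot_self_cross]
  have hgw : g ⬝ᵥ A *ᵥ w = 0 := by rw [dotProduct_comm, hg, dot_cross_self]
  have hcongr : ∀ p : F, (of ![p • w, g, e])ᵀᵀ * A * (of ![p • w, g, e])ᵀ =
      !![0, 0, p * (w ⬝ᵥ A *ᵥ e); 0, g ⬝ᵥ A *ᵥ g, 0; p * (w ⬝ᵥ A *ᵥ e), 0, 0] := by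
    intro p
    have hentry : ∀ i j, ((of ![p • w, g, e])ᵀᵀ * A * (of ![p • w, g, e])ᵀ) i j =
        (![p • w, g, e] i) ⬝ᵥ A *ᵥ (![p • w, g, e] j) := by
      intro i j
      rw [mul_assoc, mul_apply]
      rfl
    ext i j
    rw [hentry]
    fin_cases i <;> fin_cases j <;>
      simp [mulVec_smul, hw, he, hge, hgw, dotProduct_mulVec_comm hsymm e w,
        dotProduct_mulVec_comm hsymm e g, dotProduct_mulVec_comm hsymm w g]
  have hdet1 : (of ![w, g, e])ᵀ.det ≠ 0 := by
    rw [det_transpose]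
    have : (of ![w, g, e]).det = -(w ⬝ᵥ A *ᵥ e) ^ 2 := by
      change det ![w, g, e] = _
      rw [← triple_product_eq_det, triple_product_permutation, hg, cross_dot_cross,
        dotProduct_comm _ e, dotProduct_comm _ w, dotProduct_comm _ e, dotProduct_comm _ w, he, hw,
        dotProduct_mulVec_comm hsymm e w]
      ring
    rw [this]
    exact neg_ne_zero.2 (pow_ne_zero 2 hwe)
  have hgg : g ⬝ᵥ A *ᵥ g ≠ 0 := by
    intro h
    have h1 := hcongr 1
    rw [one_smul] at h1
    apply det_congr_ne_zero hdet hdet1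
    rw [h1, h, det_fin_three]
    simp
  set p : F := -(g ⬝ᵥ A *ᵥ g) / (2 * (w ⬝ᵥ A *ᵥ e)) with hp
  have hγ : (of ![p • w, g, e])ᵀᵀ * A * (of ![p • w, g, e])ᵀ =
      ((g ⬝ᵥ A *ᵥ g) / 2) • stdConic := by
    rw [hcongr]
    have : p * (w ⬝ᵥ A *ᵥ e) = -(g ⬝ᵥ A *ᵥ g) / 2 := by
      rw [hp]; field_simp
    rw [this]
    ext i j
    fin_cases i <;> fin_cases j <;> simp [stdConic] <;> ring
  refine ⟨(of ![p • w, g, e])ᵀ, fun h0 => ?_, ?_, (g ⬝ᵥ A *ᵥ g) / 2,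
    div_ne_zero hgg two_ne_zero, hγ⟩
  · have := congrArg det hγ
    rw [det_mul, h0, mul_zero, det_smul, det_stdConic] at this
    simp [hgg] at this
  · ext i
    simp [mulVec, dotProduct, Fin.sum_univ_three]

/-- A nondegenerate conic contains no line: two conjugate points of it coincide. -/
lemma exists_smul_of_isotropic [CharZero F] {A : Matrix (Fin 3) (Fin 3) F} (hA : IsConic A)
    {v w : Fin 3 → F} (hv0 : v ≠ 0) (hv : v ⬝ᵥ A *ᵥ v = 0) (hw : w ⬝ᵥ A *ᵥ w = 0)
    (hwv : w ⬝ᵥ A *ᵥ v = 0) : ∃ c : F, w = c • v := by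
  obtain ⟨G, hG, hGe, γ, hγ, hGA⟩ := exists_congr_stdConic hA hv0 hv
  have hunit : IsUnit G.det := isUnit_iff_ne_zero.2 hG
  have hwG : w = G *ᵥ (G⁻¹ *ᵥ w) := by
    rw [mulVec_mulVec, mul_nonsing_inv _ hunit, one_mulVec]
  generalize G⁻¹ *ᵥ w = u at hwG
  subst hwG
  rw [dotProduct_congr_mulVec, hGA, smul_mulVec, dotProduct_smul, smul_eq_mul, mul_eq_zero,
    or_iff_right hγ, stdConic_isotropic_iff] at hw
  rw [← hGe, dotProduct_congr_mulVec, hGA, smul_mulVec, dotProduct_smul, smul_eq_mul, mul_eq_zero,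
    or_iff_right hγ] at hwv
  have h0 : u 0 = 0 := by
    simpa [stdConic, mulVec, dotProduct, Fin.sum_univ_three] using hwv
  have h1 : u 1 = 0 := by
    rw [h0, zero_mul] at hw
    exact pow_eq_zero_iff two_ne_zero |>.1 hw
  refine ⟨u 2, ?_⟩
  rw [← hGe, ← mulVec_smul]
  congr 1
  ext i
  fin_cases i <;> simp [h0, h1]

open Polynomial in
/-- Two conics over an algebraically closed field intersect. -/
lemma exists_mem_inter [CharZero F] [IsAlgClosed F] {A B : Matrix (Fin 3) (Fin 3) F}
    (hA : IsConic A) {v : Fin 3 → F} (hv0 : v ≠ 0) (hv : v ⬝ᵥ A *ᵥ v = 0) :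
    ∃ e : Fin 3 → F, e ≠ 0 ∧ e ⬝ᵥ A *ᵥ e = 0 ∧ e ⬝ᵥ B *ᵥ e = 0 := by
  obtain ⟨G, hG, hGv, γ, hγ, hGA⟩ := exists_congr_stdConic hA hv0 hv
  obtain ⟨e, he0, heA, heB⟩ : ∃ e : Fin 3 → F, e ≠ 0 ∧ e ⬝ᵥ stdConic *ᵥ e = 0 ∧
      e ⬝ᵥ (Gᵀ * B * G) *ᵥ e = 0 := by
    generalize Gᵀ * B * G = M
    by_cases h : M 2 2 = 0
    · refine ⟨![0, 0, 1], fun h => by simpa using congrFun h 2, ?_, ?_⟩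
      · rw [stdConic_isotropic_iff]; simp
      · simp [mulVec, dotProduct, Fin.sum_univ_three, h]
    · set p : F[X] := C (M 2 2) * X ^ 4 + C (M 1 2 + M 2 1) * X ^ 3 +
        C (M 0 2 + M 1 1 + M 2 0) * X ^ 2 + C (M 0 1 + M 1 0) * X + C (M 0 0) with hp
      have hdeg : p.natDegree = 4 := by
        rw [hp]
        compute_degree!
      obtain ⟨x, hx⟩ := IsAlgClosed.exists_root p (fun h0 => by
        have := natDegree_eq_zero_iff_degree_le_zero.2 h0.le
        omega)
      refine ⟨veronese x, veronese_ne_zero x, veronese_isotropic x, ?_⟩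
      rw [IsRoot, hp] at hx
      simp only [eval_add, eval_mul, eval_C, eval_pow, eval_X] at hx
      simp [mulVec, dotProduct, Fin.sum_univ_three, veronese]
      linear_combination hx
  refine ⟨G *ᵥ e, mulVec_ne_zero hG he0, ?_, ?_⟩
  · rw [dotProduct_congr_mulVec, hGA, smul_mulVec, dotProduct_smul, heA, smul_zero]
  · rw [dotProduct_congr_mulVec, heB]

end Conics

section Projective

open Matrix Projectivization

variable {F : Type*} [Field F]

lemma onConic_mk {A : Matrix (Fin 3) (Fin 3) F} {v : Fin 3 → F} (hv : v ≠ 0) :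
    OnConic A (mk F v hv) ↔ v ⬝ᵥ A *ᵥ v = 0 := by
  obtain ⟨a, ha⟩ := exists_smul_eq_mk_rep F v hv
  rw [OnConic, ← ha, mulVec_smul, dotProduct_smul, smul_dotProduct]
  simp [Units.smul_def]

lemma isTangent_mk_iff {A : Matrix (Fin 3) (Fin 3) F} {l : Fin 3 → F}
    (hl : l ≠ 0) : IsTangent A (mk F l hl) ↔ ∃ q, A *ᵥ q = l ∧ q ⬝ᵥ l = 0 := by
  obtain ⟨a, ha⟩ := exists_smul_eq_mk_rep F l hl
  rw [Units.smul_def] at ha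
  constructor
  · rintro ⟨q, hq, c, hc, h⟩
    rw [← ha, smul_smul] at h
    have hca : c * a ≠ 0 := mul_ne_zero hc a.ne_zero
    refine ⟨(c * a : F)⁻¹ • q.rep, ?_, ?_⟩
    · rw [mulVec_smul, h, inv_smul_smul₀ hca]
    · rw [OnConic, h, dotProduct_smul, smul_eq_mul, mul_eq_zero, or_iff_right hca] at hq
      rw [smul_dotProduct, hq, smul_zero]
  · rintro ⟨q, hq, h⟩
    have hq0 : q ≠ 0 := by
      rintro rfl
      rw [mulVec_zero] at hq
      exact hl hq.symm
    obtain ⟨b, hb⟩ := exists_smul_eq_mk_rep F q hq0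
    rw [Units.smul_def] at hb
    refine ⟨mk F q hq0, (onConic_mk hq0).2 (by rw [hq, h]), b / a,
      div_ne_zero b.ne_zero a.ne_zero, ?_⟩
    rw [← hb, ← ha, mulVec_smul, hq, smul_smul, div_mul_cancel₀ _ a.ne_zero]

end Projective

/-! ### The half-step sequence of a Poncelet polygon -/

section HalfStep

open Matrix Projectivization

variable {F : Type*} [Field F]

lemma natCast_zmod_ne_zero {m i : ℕ} (hi : 0 < i) (him : i < m) : (i : ZMod m) ≠ 0 := fun h =>
  absurd (Nat.le_of_dvd hi ((ZMod.natCast_eq_zero_iff i m).1 h)) (by omega)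

lemma chord_inj [CharZero F] {x y x' y' : F} {c : F} (h : chord x y = c • chord x' y') :
    x = x' ∧ y = y' ∨ x = y' ∧ y = x' := by
  have h2 := congrFun h 2
  have h1 := congrFun h 1
  have h0 := congrFun h 0
  simp [chord] at h0 h1 h2
  rw [← h2] at h0 h1
  have : (x - x') * (x - y') = 0 := by linear_combination x * h1 - h0 - 2 * x * h1
  rcases mul_eq_zero.1 this with h | h
  · left
    have hx : x = x' := sub_eq_zero.1 h
    exact ⟨hx, by linear_combination -h1 - hx⟩
  · right
    have hx : x = y' := sub_eq_zero.1 h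
    exact ⟨hx, by linear_combination -h1 - hx⟩

lemma cross_smul_smul (c d : F) (v w : Fin 3 → F) :
    crossProduct (c • v) (d • w) = (c * d) • crossProduct v w := by
  rw [map_smul, LinearMap.map_smul₂, smul_smul, mul_comm]

/-- A Poncelet polygon over an algebraically closed field, in coordinates where its conic is the
standard one and where the point at infinity belongs to both conics: the parameters `y n` of its
vertices, together with the tangency of the sides to the second conic `X`. -/
lemma IsPonceletPolygon.exists_normal_form [CharZero F] [IsAlgClosed F] {m : ℕ}
    {P : ZMod m → Plane F} (hP : IsPonceletPolygon P) :
    ∃ (G X : Matrix (Fin 3) (Fin 3) F) (y : ZMod m → F), G.det ≠ 0 ∧ IsConic X ∧ X 2 2 = 0 ∧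
      Function.Injective y ∧
      (∀ n, ∃ h, P n = mk F (G *ᵥ veronese (y n)) h) ∧
      ∀ n, ∃ q, X *ᵥ q = chord (y n) (y (n + 1)) ∧ q ⬝ᵥ X *ᵥ q = 0 := by
  classical
  obtain ⟨hm, hinj, A, B, hA, hB, hPA, hPB⟩ := hP
  have h1 : (1 : ZMod m) ≠ 0 := by
    exact_mod_cast natCast_zmod_ne_zero one_pos (by omega : 1 < m)
  have h2 : (2 : ZMod m) ≠ 0 := by
    exact_mod_cast natCast_zmod_ne_zero two_pos (by omega : 2 < m)
  have hPA' : ∀ n, (P n).rep ⬝ᵥ A *ᵥ (P n).rep = 0 := hPA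
  obtain ⟨e, he0, heA, heB⟩ := exists_mem_inter (B := B) hA (P 0).rep_nonzero (hPA' 0)
  obtain ⟨G, hG, hGe, γ, hγ, hGA⟩ := exists_congr_stdConic hA he0 heA
  have hunit : IsUnit G.det := isUnit_iff_ne_zero.2 hG
  set X := Gᵀ * B * G with hX
  have hXc : IsConic X := ⟨isSymm_congr hB.1 G, det_congr_ne_zero hB.2 hG⟩
  have hXe : ![0, 0, 1] ⬝ᵥ X *ᵥ ![0, 0, 1] = 0 := by
    rw [hX, ← dotProduct_congr_mulVec, hGe, heB]
  have hX22 : X 2 2 = 0 := by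
    simpa [mulVec, dotProduct, Fin.sum_univ_three] using hXe
  -- Homogeneous coordinates of the vertices in the new coordinate system.
  have hu : ∀ n, ∃ u : Fin 3 → F, u ≠ 0 ∧ u ⬝ᵥ stdConic *ᵥ u = 0 ∧
      ∃ h, P n = mk F (G *ᵥ u) h := by
    intro n
    have hGu : G *ᵥ (G⁻¹ *ᵥ (P n).rep) = (P n).rep := by
      rw [mulVec_mulVec, mul_nonsing_inv _ hunit, one_mulVec]
    refine ⟨G⁻¹ *ᵥ (P n).rep, fun h0 => (P n).rep_nonzero ?_, ?_, ?_⟩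
    · rw [← hGu, h0, mulVec_zero]
    · have := hPA' n
      rw [← hGu, dotProduct_congr_mulVec, hGA, smul_mulVec, dotProduct_smul, smul_eq_mul,
        mul_eq_zero, or_iff_right hγ] at this
      exact this
    · exact ⟨by rw [hGu]; exact (P n).rep_nonzero, by simp only [hGu, mk_rep]⟩
  choose u hu0 hu hPu0 hPu using hu
  have hcross : ∀ n, crossProduct (u n) (u (n + 1)) ≠ 0 := by
    intro n h0
    have hne : P n ≠ P (n + 1) := fun h => h1 (by simpa using hinj h)
    rw [hPu n, hPu (n + 1)] at hne
    apply hne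
    have hz := transpose_mulVec_cross G (u n) (u (n + 1))
    rw [h0, smul_zero] at hz
    exact (mk_eq_mk_iff_crossProduct_eq_zero _ _).2
      (eq_zero_of_mulVec_eq_zero (by rwa [det_transpose]) hz)
  have htan : ∀ n, ∃ q, X *ᵥ q = crossProduct (u n) (u (n + 1)) ∧ q ⬝ᵥ X *ᵥ q = 0 := by
    intro n
    have h := hPB n
    have hne : P n ≠ P (n + 1) := fun h => h1 (by simpa using hinj h)
    rw [joins, Nat.cast_one, hPu n, hPu (n + 1), cross_mk_of_ne _ _ (by rwa [← hPu, ← hPu]),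
      isTangent_mk_iff] at h
    obtain ⟨q, hq, hql⟩ := h
    have hGq : G *ᵥ (G⁻¹ *ᵥ q) = q := by
      rw [mulVec_mulVec, mul_nonsing_inv _ hunit, one_mulVec]
    refine ⟨G.det⁻¹ • (G⁻¹ *ᵥ q), ?_, ?_⟩
    · rw [mulVec_smul, hX, ← mulVec_mulVec, hGq, ← mulVec_mulVec, hq, transpose_mulVec_cross,
        inv_smul_smul₀ hG]
    · rw [mulVec_smul, dotProduct_smul, smul_dotProduct, hX, ← dotProduct_congr_mulVec, hGq, hq,
        hql, smul_zero, smul_zero]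
  -- If a vertex were the common point at infinity, both sides through it would be its tangent.
  have hfin : ∀ n, ∃ c x : F, c ≠ 0 ∧ u n = c • veronese x := by
    intro n
    refine (eq_smul_veronese_or (hu0 n) (hu n)).resolve_right ?_
    rintro ⟨s, hs, hn⟩
    have hside : ∀ n', (u n ⬝ᵥ crossProduct (u n') (u (n' + 1)) = 0) →
        ∃ c : F, c ≠ 0 ∧ crossProduct (u n') (u (n' + 1)) = c • X *ᵥ ![0, 0, 1] := by
      intro n' h
      obtain ⟨q, hq, hqq⟩ := htan n'
      have hq0 : q ⬝ᵥ X *ᵥ ![0, 0, 1] = 0 := by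
        rw [hn, smul_dotProduct, ← hq, dotProduct_mulVec_comm hXc.1, smul_eq_mul, mul_eq_zero,
          or_iff_right hs] at h
        exact h
      obtain ⟨c, rfl⟩ := exists_smul_of_isotropic hXc
        (fun h => by simpa using congrFun h 2) hXe hqq hq0
      refine ⟨c, ?_, by rw [← hq, mulVec_smul]⟩
      rintro rfl
      rw [zero_smul, mulVec_zero] at hq
      exact hcross n' hq.symm
    obtain ⟨c, hc, h3⟩ := hside n (dot_self_cross _ _)
    obtain ⟨c', hc', h4⟩ := hside (n - 1) (by rw [sub_add_cancel]; exact dot_cross_self _ _)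
    rw [sub_add_cancel] at h4
    have hother : ∀ n', n' ≠ n → ∃ d x : F, d ≠ 0 ∧ u n' = d • veronese x := by
      intro n' hne
      refine (eq_smul_veronese_or (hu0 n') (hu n')).resolve_right ?_
      rintro ⟨s', hs', hn'⟩
      apply hne
      apply hinj
      rw [hPu, hPu, mk_eq_mk_iff']
      exact ⟨s' / s, by rw [hn, hn', mulVec_smul, mulVec_smul, smul_smul, div_mul_cancel₀ _ hs]⟩
    obtain ⟨d, x, hd, hx⟩ := hother (n + 1) (by simpa using h1)
    obtain ⟨d', x', hd', hx'⟩ := hother (n - 1) (by simpa using h1)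
    have h5 : c' • crossProduct (u n) (u (n + 1)) = c • crossProduct (u (n - 1)) (u n) := by
      rw [h3, h4, smul_comm]
    rw [hn, hx, hx'] at h5
    have h50 := congrFun h5 0
    have h51 := congrFun h5 1
    simp [cross_apply, veronese] at h50 h51
    have hxx : x = x' := by
      have : c' * (s * d) * (x - x') = 0 := by
        linear_combination -h50 - x' * h51
      rcases mul_eq_zero.1 this with h | h
      · exact absurd h (mul_ne_zero hc' (mul_ne_zero hs hd))
      · exact sub_eq_zero.1 h
    have : n + 1 = n - 1 := by
      apply hinj
      rw [hPu, hPu, mk_eq_mk_iff']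
      exact ⟨d / d', by
        rw [hx, hx', hxx, mulVec_smul, mulVec_smul, smul_smul, div_mul_cancel₀ _ hd']⟩
    apply h2
    linear_combination this
  choose c y hc hy using hfin
  refine ⟨G, X, y, hG, hXc, hX22, fun n n' h => hinj ?_, fun n => ?_, fun n => ?_⟩
  · rw [hPu, hPu, mk_eq_mk_iff']
    refine ⟨c n / c n', ?_⟩
    rw [hy n, hy n', h, mulVec_smul, mulVec_smul, smul_smul, div_mul_cancel₀ _ (hc n')]
  · refine ⟨mulVec_ne_zero hG (veronese_ne_zero _), ?_⟩
    rw [hPu, mk_eq_mk_iff']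
    exact ⟨c n, by rw [hy n, mulVec_smul]⟩
  · obtain ⟨q, hq, hqq⟩ := htan n
    rw [hy n, hy (n + 1), cross_smul_smul, cross_veronese, smul_smul] at hq
    have ht : c n * c (n + 1) * (y (n + 1) - y n) ≠ 0 := by
      intro h0
      apply hcross n
      rw [hy n, hy (n + 1), cross_smul_smul, cross_veronese, smul_smul, h0, zero_smul]
    refine ⟨(c n * c (n + 1) * (y (n + 1) - y n))⁻¹ • q, ?_, ?_⟩
    · rw [mulVec_smul, hq, inv_smul_smul₀ ht]
    · rw [mulVec_smul, dotProduct_smul, smul_dotProduct, hqq, smul_zero, smul_zero]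

/-- The vertices of a Poncelet polygon are every other point of a sequence with chord operators:
between two consecutive vertices there is one more point of the conic, the image of their
side under the inverse of a square root of the second conic. -/
theorem IsPonceletPolygon.exists_halfStep [CharZero F] [IsAlgClosed F] {m : ℕ}
    {P : ZMod m → Plane F} (hP : IsPonceletPolygon P) :
    ∃ (G : Matrix (Fin 3) (Fin 3) F) (x : ℤ → F), G.det ≠ 0 ∧ HasChordOperators x ∧
      (∀ n : ℤ, ∃ h, P n = mk F (G *ᵥ veronese (x (2 * n))) h) ∧
      ∀ k d : ℤ, x k = x (k + 2 * d) ↔ (m : ℤ) ∣ d := by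
  have hm := hP.1
  obtain ⟨G, X, y, hG, hX, hX22, hinj, hPy, hq⟩ := hP.exists_normal_form
  have h1 : (1 : ZMod m) ≠ 0 := by
    exact_mod_cast natCast_zmod_ne_zero one_pos (by omega : 1 < m)
  have h2 : (2 : ZMod m) ≠ 0 := by
    exact_mod_cast natCast_zmod_ne_zero two_pos (by omega : 2 < m)
  obtain ⟨T, hT, hTX, hT12⟩ := exists_conic_sqrt hX.1 hX.2 hX22
  have hTdet : T.det ≠ 0 := by
    intro h
    apply hX.2
    rw [← hTX, det_mul, h, mul_zero]
  have hz : ∀ n, ∃ z c : F, c ≠ 0 ∧ T *ᵥ veronese z = c • chord (y n) (y (n + 1)) := by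
    intro n
    obtain ⟨q, hq, hqq⟩ := hq n
    set h := stdConicInv *ᵥ (T *ᵥ q) with hh
    have hTh : T *ᵥ h = chord (y n) (y (n + 1)) := by
      rw [hh, mulVec_mulVec, mulVec_mulVec, hTX, hq]
    have hJh : stdConic *ᵥ h = T *ᵥ q := by
      rw [hh, mulVec_mulVec, stdConic_mul_stdConicInv, one_mulVec]
    have hiso : h ⬝ᵥ stdConic *ᵥ h = 0 := by
      rw [hJh, dotProduct_mulVec_comm hT, hTh, ← hq, hqq]
    have hh0 : h ≠ 0 := by
      intro h0
      rw [h0, mulVec_zero] at hTh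
      exact chord_ne_zero _ _ hTh.symm
    rcases eq_smul_veronese_or hh0 hiso with ⟨c, z, hc, he⟩ | ⟨c, hc, he⟩
    · refine ⟨z, c⁻¹, inv_ne_zero hc, ?_⟩
      rw [← hTh, he, mulVec_smul, inv_smul_smul₀ hc]
    · exfalso
      have h3 := chord_dotProduct_stdConicInv (y n) (y (n + 1))
      rw [← hTh, he, dotProduct_congr_mulVec, hT.eq, hTX] at h3
      have h4 : y n = y (n + 1) := by
        have : (y n - y (n + 1)) ^ 2 = 0 := by
          simp [mulVec, dotProduct, Fin.sum_univ_three, hX22] at h3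
          linear_combination -2 * h3
        exact sub_eq_zero.1 (pow_eq_zero_iff two_ne_zero |>.1 this)
      exact h1 (by simpa using hinj h4)
  choose z c hc hz using hz
  have hzinj : Function.Injective z := by
    intro n n' h
    have h3 : chord (y n) (y (n + 1)) = ((c n)⁻¹ * c n') • chord (y n') (y (n' + 1)) := by
      rw [← smul_smul, ← hz, ← h, hz, inv_smul_smul₀ (hc n)]
    rcases chord_inj h3 with ⟨h4, -⟩ | ⟨h4, h5⟩
    · exact hinj h4
    · have h6 := hinj h4
      have h7 := hinj h5
      exact absurd (show (2 : ZMod m) = 0 by linear_combination h7 - h6) h2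
  set x : ℤ → F := fun k => if Even k then y ((k / 2 : ℤ) : ZMod m) else z ((k / 2 : ℤ) : ZMod m)
    with hxdef
  have hxe : ∀ n : ℤ, x (2 * n) = y (n : ZMod m) := fun n => by simp [hxdef]
  have hxo : ∀ n : ℤ, x (2 * n + 1) = z (n : ZMod m) := fun n => by
    have h3 : ¬ Even (2 * n + 1) := by simp
    have h4 : (2 * n + 1) / 2 = n := by omega
    simp only [hxdef, if_neg h3, h4]
  have hTz : ∀ n w, (w = y n ∨ w = y (n + 1)) → veronese w ⬝ᵥ T *ᵥ veronese (z n) = 0 := by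
    intro n w hw
    rw [hz, dotProduct_smul, veronese_dotProduct_chord]
    rcases hw with rfl | rfl <;> simp
  refine ⟨G, x, hG, hasChordOperators_of_biquadratic hT hTdet (fun k => ?_) (fun k => ?_)
    (by rw [hTX, hX22]) (by rw [hTX]; exact hT12), fun n => ?_, fun k d => ?_⟩
  · rcases Int.even_or_odd' k with ⟨n, rfl | rfl⟩
    · rw [hxe, hxo]
      exact hTz _ _ (Or.inl rfl)
    · rw [hxo, show 2 * n + 1 + 1 = 2 * (n + 1) by ring, hxe, dotProduct_mulVec_comm hT]
      exact hTz _ _ (Or.inr (by push_cast; rfl))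
  · rcases Int.even_or_odd' k with ⟨n, rfl | rfl⟩
    · rw [hxo, show 2 * n - 1 = 2 * (n - 1) + 1 by ring, hxo]
      intro h
      have := hzinj h
      push_cast at this
      exact h1 (by linear_combination this)
    · rw [show 2 * n + 1 + 1 = 2 * (n + 1) by ring, show 2 * n + 1 - 1 = 2 * n by ring, hxe, hxe]
      intro h
      have := hinj h
      push_cast at this
      exact h1 (by linear_combination this)
  · simp only [hxe]
    exact hPy n
  · rw [← ZMod.intCast_zmod_eq_zero_iff_dvd]
    rcases Int.even_or_odd' k with ⟨n, rfl | rfl⟩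
    · rw [show 2 * n + 2 * d = 2 * (n + d) by ring, hxe, hxe, hinj.eq_iff]
      simp
    · rw [show 2 * n + 1 + 2 * d = 2 * (n + d) + 1 by ring, hxo, hxo, hzinj.eq_iff]
      simp

end HalfStep

/-! ### Points of conics and the words of the construction -/

section ConicPoint

open Matrix Projectivization

variable {F : Type*} [Field F]

/-- The image under the projective transformation `M` of the point with parameter `x` on the
standard conic. -/
def conicPoint (M : Matrix (Fin 3) (Fin 3) F) (hM : M.det ≠ 0) (x : F) : Plane F :=
  mk F (M *ᵥ veronese x) (mulVec_ne_zero hM (veronese_ne_zero x))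

lemma conicPoint_congr {M M' : Matrix (Fin 3) (Fin 3) F} {hM : M.det ≠ 0} {hM' : M'.det ≠ 0}
    (h : M = M') {x x' : F} (hx : x = x') : conicPoint M hM x = conicPoint M' hM' x' := by
  subst h hx
  rfl

lemma conicPoint_inj {M : Matrix (Fin 3) (Fin 3) F} {hM : M.det ≠ 0} {x y : F} :
    conicPoint M hM x = conicPoint M hM y ↔ x = y := by
  refine ⟨fun h => ?_, fun h => by rw [h]⟩
  rw [conicPoint, conicPoint, mk_eq_mk_iff'] at h
  obtain ⟨c, hc⟩ := h
  rw [← mulVec_smul] at hc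
  have := sub_eq_zero.1 (eq_zero_of_mulVec_eq_zero hM
    ((mulVec_sub M _ _).trans (sub_eq_zero.2 hc)))
  have h0 := congrFun this 0
  have h1 := congrFun this 1
  simp [veronese] at h0 h1
  rw [← h1, h0, one_mul]

lemma det_inv_transpose_mul_ne_zero {M S : Matrix (Fin 3) (Fin 3) F} (hM : M.det ≠ 0)
    (hS : S.det ≠ 0) : (M⁻¹ᵀ * S).det ≠ 0 := by
  rw [det_mul, det_transpose, det_nonsing_inv, Ring.inverse_eq_inv']
  exact mul_ne_zero (inv_ne_zero hM) hS

lemma conicPoint_cross [DecidableEq F] {M S : Matrix (Fin 3) (Fin 3) F} {hM : M.det ≠ 0}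
    (hS : S.det ≠ 0) {x y z c : F} (hxy : x ≠ y) (hc : c ≠ 0)
    (h : S *ᵥ veronese z = c • chord x y) :
    (conicPoint M hM x).cross (conicPoint M hM y) =
      conicPoint (M⁻¹ᵀ * S) (det_inv_transpose_mul_ne_zero hM hS) z := by
  have hne : conicPoint M hM x ≠ conicPoint M hM y := fun h' => hxy (conicPoint_inj.1 h')
  rw [conicPoint, conicPoint] at hne
  rw [conicPoint, conicPoint, conicPoint, cross_mk_of_ne _ _ hne, mk_eq_mk_iff']
  have hMT : IsUnit Mᵀ.det := by rw [det_transpose]; exact isUnit_iff_ne_zero.2 hM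
  have h1 : M⁻¹ᵀ *ᵥ (Mᵀ *ᵥ crossProduct (M *ᵥ veronese x) (M *ᵥ veronese y)) =
      crossProduct (M *ᵥ veronese x) (M *ᵥ veronese y) := by
    rw [mulVec_mulVec, transpose_nonsing_inv, nonsing_inv_mul _ hMT, one_mulVec]
  refine ⟨M.det * (y - x) / c, ?_⟩
  rw [← h1, transpose_mulVec_cross, cross_veronese, ← mulVec_mulVec, h, ← mulVec_smul, smul_smul,
    smul_smul, div_mul_cancel₀ _ hc]

end ConicPoint

section Rings

open Matrix Projectivization

variable {F : Type*} [Field F]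

/-- A sequence of parameters with chord operators `S`, in which every other point is a vertex of an
`m`-gon. -/
structure IsHalfStepSequence (m : ℕ) (S : ℕ → Matrix (Fin 3) (Fin 3) F) (x : ℤ → F) : Prop where
  symm : ∀ j, (S j).IsSymm
  comm : ∀ i j, S i * stdConicInv * S j = S j * stdConicInv * S i
  map : ∀ (j : ℕ) (k : ℤ), ∃ c : F, c ≠ 0 ∧
    S j *ᵥ veronese (x k) = c • chord (x (k + j)) (x (k - j))
  period : ∀ k d : ℤ, x k = x (k + 2 * d) ↔ (m : ℤ) ∣ d

namespace IsHalfStepSequence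

variable {m : ℕ} {S : ℕ → Matrix (Fin 3) (Fin 3) F} {x : ℤ → F}

lemma ne_of_lt (hx : IsHalfStepSequence m S x) {k d : ℤ} (hd : d ≠ 0) (hlt : |d| < m) :
    x k ≠ x (k + 2 * d) := fun h =>
  hd (Int.eq_zero_of_abs_lt_dvd ((hx.period k d).1 h) hlt)

/-- If a chord operator were singular, all chords of the corresponding length would be concurrent. -/
lemma det_ne_zero (hx : IsHalfStepSequence m S x) {i : ℕ} (hi : 0 < i) (him : 2 * i < m) :
    (S i).det ≠ 0 := by
  intro h0
  obtain ⟨z, hz0, hz⟩ := exists_mulVec_eq_zero_iff.2 h0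
  have hchord : ∀ k : ℤ, z ⬝ᵥ chord (x (k + i)) (x (k - i)) = 0 := by
    intro k
    obtain ⟨c, hc, h⟩ := hx.map i k
    have : z ⬝ᵥ S i *ᵥ veronese (x k) = 0 := by
      rw [dotProduct_mulVec_comm (hx.symm i), hz, dotProduct_zero]
    rw [h, dotProduct_smul, smul_eq_mul, mul_eq_zero, or_iff_right hc] at this
    exact this
  have hz1 : ∀ k : ℤ, z 1 = z 0 * x k ∧ z 2 = z 0 * x k ^ 2 := by
    intro k
    have h1 := hchord (k + i)
    have h2 := hchord (k - i)
    rw [add_sub_cancel_right] at h1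
    rw [sub_add_cancel] at h2
    have hne : x (k - i - i) - x (k + i + i) ≠ 0 := by
      rw [sub_ne_zero, show k + i + i = k - i - i + 2 * (2 * i) by ring]
      exact hx.ne_of_lt (by positivity) (by rw [abs_of_nonneg (by positivity)]; exact_mod_cast him)
    simp [chord, dotProduct, Fin.sum_univ_three] at h1 h2
    have h3 : z 1 = z 0 * x k := by
      have : (x (k - i - i) - x (k + i + i)) * (z 1 - z 0 * x k) = 0 := by
        linear_combination h1 - h2
      exact sub_eq_zero.1 ((mul_eq_zero.1 this).resolve_left hne)
    exact ⟨h3, by linear_combination h1 + (x (k + i + i) + x k) * h3⟩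
  have hz00 : z 0 ≠ 0 := by
    intro h
    apply hz0
    ext a
    fin_cases a
    · simp [h]
    · simp [(hz1 0).1, h]
    · simp [(hz1 0).2, h]
  have h1 := (hz1 0).1
  rw [(hz1 (0 + 2 * 1)).1] at h1
  exact hx.ne_of_lt (k := 0) one_ne_zero (by rw [abs_one]; exact_mod_cast (by omega : 1 < m))
    (mul_left_cancel₀ hz00 h1).symm

/-- The two chords joining a point of the sequence to two different other ones are different. -/
lemma conicPoint_ne (hx : IsHalfStepSequence m S x) {i j : ℕ} (hj : 0 < j)
    (him : 2 * i < m) (hjm : 2 * j < m) (hij : i ≠ j) {M : Matrix (Fin 3) (Fin 3) F}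
    {hM : (M * S i).det ≠ 0} {hM' : (M * S j).det ≠ 0} {ε δ : ℤ} (hε : ε = 1 ∨ ε = -1)
    (hδ : δ = 1 ∨ δ = -1) (κ : ℤ) {k k' : ℤ} (hk : k = κ + ε * i) (hk' : k' = κ + δ * j)
    [CharZero F] :
    conicPoint (M * S i) hM (x k) ≠ conicPoint (M * S j) hM' (x k') := by
  subst hk hk'
  intro h
  have hM0 : M.det ≠ 0 := by
    rw [det_mul] at hM
    exact left_ne_zero_of_mul hM
  rw [conicPoint, conicPoint, mk_eq_mk_iff'] at h
  obtain ⟨c, hc⟩ := h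
  rw [← mulVec_mulVec, ← mulVec_mulVec, ← mulVec_smul] at hc
  have hS := sub_eq_zero.1 (eq_zero_of_mulVec_eq_zero hM0
    ((mulVec_sub M _ _).trans (sub_eq_zero.2 hc)))
  have hend : ∀ (i : ℕ) (ε : ℤ), (ε = 1 ∨ ε = -1) → ∃ c : F, c ≠ 0 ∧
      S i *ᵥ veronese (x (κ + ε * i)) = c • chord (x κ) (x (κ + 2 * (ε * i))) := by
    rintro i ε hε
    obtain ⟨c, hc, h⟩ := hx.map i (κ + ε * i)
    refine ⟨c, hc, ?_⟩
    rw [h]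
    rcases hε with rfl | rfl
    · rw [show κ + 1 * (i : ℤ) - i = κ by ring, show κ + 1 * (i : ℤ) + i = κ + 2 * (1 * i) by ring,
        chord, chord, mul_comm, add_comm (x κ)]
    · rw [show κ + -1 * (i : ℤ) + i = κ by ring,
        show κ + -1 * (i : ℤ) - i = κ + 2 * (-1 * i) by ring]
  obtain ⟨c₁, hc₁, h₁⟩ := hend i ε hε
  obtain ⟨c₂, hc₂, h₂⟩ := hend j δ hδ
  rw [h₁, h₂] at hS
  have hch : chord (x κ) (x (κ + 2 * (ε * i))) =
      (c₁⁻¹ * (c * c₂)) • chord (x κ) (x (κ + 2 * (δ * j))) := by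
    rw [← smul_smul, ← smul_smul c, hS, inv_smul_smul₀ hc₁]
  have hδj : |δ * (j : ℤ)| = j := by
    rcases hδ with rfl | rfl <;> simp
  have hne : (x κ) ≠ x (κ + 2 * (δ * j)) := hx.ne_of_lt
    (by rw [← abs_pos, hδj]; exact_mod_cast hj) (by rw [hδj]; exact_mod_cast (by omega : j < m))
  rcases chord_inj hch with ⟨-, h⟩ | ⟨h, -⟩
  · rw [show κ + 2 * (δ * (j : ℤ)) = κ + 2 * (ε * i) + 2 * (δ * j - ε * i) by ring] at h
    revert h
    apply hx.ne_of_lt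
    · rcases hε with rfl | rfl <;> rcases hδ with rfl | rfl <;> omega
    · rw [abs_lt]
      rcases hε with rfl | rfl <;> rcases hδ with rfl | rfl <;> constructor <;> omega
  · exact hne h

lemma cross_eq [DecidableEq F] (hx : IsHalfStepSequence m S x) {i : ℕ} (hi : 0 < i)
    (him : 2 * i < m) {M : Matrix (Fin 3) (Fin 3) F} {hM : M.det ≠ 0} {κ k k' : ℤ}
    (hk : k = κ + i) (hk' : k' = κ - i) :
    (conicPoint M hM (x k)).cross (conicPoint M hM (x k')) =
      conicPoint (M⁻¹ᵀ * S i) (det_inv_transpose_mul_ne_zero hM (hx.det_ne_zero hi him)) (x κ) := by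
  subst hk hk'
  obtain ⟨c, hc, h⟩ := hx.map i κ
  refine conicPoint_cross (hx.det_ne_zero hi him) (fun h' => ?_) hc h
  rw [show κ + (i : ℤ) = κ - i + 2 * i by ring] at h'
  exact hx.ne_of_lt (by exact_mod_cast hi.ne')
    (by rw [abs_of_nonneg (by positivity)]; exact_mod_cast (by omega : i < m)) h'.symm

end IsHalfStepSequence

section Construction

variable {m k : ℕ} [NeZero k]

/-- The projective transformation in the description of the `n`-th ring of points of the
construction, which starts with the image under `G` of a polygon on the standard conic. -/
noncomputable def ringTransformation (S : ℕ → Matrix (Fin 3) (Fin 3) F) (a b : Fin k → ℕ)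
    (G : Matrix (Fin 3) (Fin 3) F) : ℕ → Matrix (Fin 3) (Fin 3) F
  | 0 => G
  | n + 1 => ringTransformation S a b G n * (S (a (Fin.ofNat k n)))⁻¹ * S (b (Fin.ofNat k n))

/-- The first `n` letters of a cyclic word. -/
def letters (a : Fin k → ℕ) (n : ℕ) : List ℕ := (List.range n).map fun i => a (Fin.ofNat k i)

/-- The shift of the indices in the half-step sequence in the description of the `n`-th ring of
points. -/
def ringShift (a b : Fin k → ℕ) (n : ℕ) : ℤ := (letters a n).sum - (letters b n).sum

lemma letters_succ (a : Fin k → ℕ) (n : ℕ) :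
    letters a (n + 1) = letters a n ++ [a (Fin.ofNat k n)] := by
  simp [letters, List.range_succ]

lemma letters_eq_ofFn (a : Fin k → ℕ) : letters a k = List.ofFn a := by
  apply List.ext_getElem
  · simp [letters]
  · intro i h1 h2
    simp only [letters, List.getElem_map, List.getElem_range, List.getElem_ofFn]
    congr 1
    ext
    simp only [letters, List.length_map, List.length_range] at h1
    simp [Nat.mod_eq_of_lt h1]

lemma ringShift_succ (a b : Fin k → ℕ) (n : ℕ) :
    ringShift a b (n + 1) = ringShift a b n + a (Fin.ofNat k n) - b (Fin.ofNat k n) := by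
  simp only [ringShift, letters_succ, List.sum_append, List.sum_singleton]
  push_cast
  ring

end Construction

end Rings

/-! ### The closing theorem and the incidences -/

section Closing

open Matrix Projectivization

variable {F : Type*} [Field F] {m k : ℕ} [NeZero k] {S : ℕ → Matrix (Fin 3) (Fin 3) F} {x : ℤ → F}
  {a b : Fin k → ℕ} {G : Matrix (Fin 3) (Fin 3) F}

lemma det_ringTransformation_ne_zero (hx : IsHalfStepSequence m S x)
    (hab : IsTrivialCelestialSymbol m a b) (hG : G.det ≠ 0) (n : ℕ) :
    (ringTransformation S a b G n).det ≠ 0 := by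
  induction n with
  | zero => exact hG
  | succ n ih =>
    rw [ringTransformation, det_mul, det_mul, det_nonsing_inv, Ring.inverse_eq_inv']
    exact mul_ne_zero (mul_ne_zero ih (inv_ne_zero (hx.det_ne_zero (hab.a_pos _) (hab.a_lt _))))
      (hx.det_ne_zero (hab.b_pos _) (hab.b_lt _))

/-- The commuting factors of the transformations cancel when the letters of both words agree up
to order. -/
lemma ringTransformation_self (hx : IsHalfStepSequence m S x)
    (hab : IsTrivialCelestialSymbol m a b) [CharZero F] :
    ringTransformation S a b G k = G := by
  set N : ℕ → Matrix (Fin 3) (Fin 3) F := fun i => stdConicInv * S i with hN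
  have hcomm : ∀ i j, Commute (N i) (N j) := fun i j => by
    simp only [hN, Commute, SemiconjBy]
    rw [mul_assoc, ← mul_assoc (S i), hx.comm, mul_assoc, mul_assoc]
  have hJdet : (stdConicInv : Matrix (Fin 3) (Fin 3) F).det ≠ 0 := fun h => by
    have := congrArg Matrix.det (stdConicInv_mul_stdConic (F := F))
    rw [Matrix.det_mul, h] at this
    simp at this
  have hprod : ∀ n, ringTransformation S a b G n * ((letters a n).map N).prod =
      G * ((letters b n).map N).prod := by
    intro n
    induction n with
    | zero => simp [ringTransformation, letters]
    | succ n ih =>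
      have hunit : IsUnit (S (a (Fin.ofNat k n))).det :=
        isUnit_iff_ne_zero.2 (hx.det_ne_zero (hab.a_pos _) (hab.a_lt _))
      have h1 : (S (a (Fin.ofNat k n)))⁻¹ * S (b (Fin.ofNat k n)) * N (a (Fin.ofNat k n)) =
          N (b (Fin.ofNat k n)) := by
        simp only [hN]
        rw [mul_assoc, ← mul_assoc (S (b _)), hx.comm, mul_assoc,
          nonsing_inv_mul_cancel_left _ _ hunit]
      have hc : ∀ i l, Commute ((l : List ℕ).map N).prod (N i) := fun i l =>
        Commute.list_prod_left _ _ fun y hy => by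
          obtain ⟨j, -, rfl⟩ := List.mem_map.1 hy
          exact hcomm j i
      rw [letters_succ, letters_succ, List.map_append, List.map_append, List.prod_append,
        List.prod_append, List.map_singleton, List.map_singleton, List.prod_singleton,
        List.prod_singleton, (hc _ _).eq, ← mul_assoc G, ← ih, ringTransformation]
      calc _ = ringTransformation S a b G n * ((S (a (Fin.ofNat k n)))⁻¹ *
            S (b (Fin.ofNat k n)) * N (a (Fin.ofNat k n))) * ((letters a n).map N).prod := by
            simp only [mul_assoc]
        _ = _ := by rw [h1, mul_assoc (ringTransformation S a b G n) (N _),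
            mul_assoc (ringTransformation S a b G n), (hc _ _).eq]
  have hperm : (letters a k).Perm (letters b k) := by
    have := hab.multiset_eq
    rw [Fin.univ_val_map, Fin.univ_val_map, Multiset.coe_eq_coe] at this
    rwa [letters_eq_ofFn, letters_eq_ofFn]
  have hdet : ∀ l : List ℕ, (∀ i ∈ l, 0 < i ∧ 2 * i < m) → ((l.map N).prod).det ≠ 0 := by
    intro l hl
    induction l with
    | nil => simp
    | cons i l ih =>
      rw [List.map_cons, List.prod_cons, det_mul, det_mul]
      have := hl i (by simp)
      exact mul_ne_zero (mul_ne_zero hJdet (hx.det_ne_zero this.1 this.2))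
        (ih fun j hj => hl j (by simp [hj]))
  have h1 := hprod k
  rw [((hperm.map N).prod_eq' (List.pairwise_map.2 (List.pairwise_of_forall fun i j => hcomm i j)))]
    at h1
  have hunit : IsUnit ((letters b k).map N).prod.det := isUnit_iff_ne_zero.2 (hdet _ (by
    intro i hi
    obtain ⟨j, -, rfl⟩ := List.mem_map.1 hi
    exact ⟨hab.b_pos _, hab.b_lt _⟩))
  calc _ = ringTransformation S a b G k * ((letters b k).map N).prod *
        ((letters b k).map N).prod⁻¹ := (mul_nonsing_inv_cancel_right _ _ hunit).symm
    _ = _ := by rw [h1, mul_nonsing_inv_cancel_right _ _ hunit]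

lemma ringShift_self (hab : IsTrivialCelestialSymbol m a b) : ringShift a b k = 0 := by
  have := hab.multiset_eq
  rw [Fin.univ_val_map, Fin.univ_val_map, Multiset.coe_eq_coe] at this
  rw [ringShift, letters_eq_ofFn, letters_eq_ofFn, this.sum_eq, sub_self]

/-- Every ring of points is the image under a projective transformation of the half-step sequence
that contains the polygon, with shifted indices. -/
lemma pointRing_eq_conicPoint (hx : IsHalfStepSequence m S x)
    (hab : IsTrivialCelestialSymbol m a b) (hG : G.det ≠ 0) {P : ZMod m → Plane F}
    (hP : ∀ n : ℤ, P n = conicPoint G hG (x (2 * n))) (j : ℕ) (n : ℤ) :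
    pointRing a b P j n = conicPoint (ringTransformation S a b G j)
      (det_ringTransformation_ne_zero hx hab hG j) (x (2 * n + ringShift a b j)) := by
  classical
  induction j generalizing n with
  | zero =>
    rw [pointRing, hP]
    exact conicPoint_congr rfl (by simp [ringShift, letters])
  | succ j ih =>
    have hline : ∀ n : ℤ, joins (a (Fin.ofNat k j)) (pointRing a b P j) n =
        conicPoint ((ringTransformation S a b G j)⁻¹ᵀ * S (a (Fin.ofNat k j)))
          (det_inv_transpose_mul_ne_zero (det_ringTransformation_ne_zero hx hab hG j)
            (hx.det_ne_zero (hab.a_pos _) (hab.a_lt _)))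
          (x (2 * n + ringShift a b j + a (Fin.ofNat k j))) := by
      intro n
      have h := ih (n + (a (Fin.ofNat k j) : ℤ))
      push_cast at h
      rw [joins, ih n, h, cross_comm]
      exact hx.cross_eq (hab.a_pos _) (hab.a_lt _) (by ring) (by ring)
    have h := hline (n - (b (Fin.ofNat k j) : ℤ))
    push_cast at h
    rw [pointRing, meets, hline n, h, hx.cross_eq (hab.b_pos (Fin.ofNat k j)) (hab.b_lt _)
      (κ := 2 * n + ringShift a b (j + 1)) (by rw [ringShift_succ]; ring)
      (by rw [ringShift_succ]; ring)]
    refine conicPoint_congr ?_ rfl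
    have hW : (ringTransformation S a b G j)⁻¹ᵀ⁻¹ᵀ = ringTransformation S a b G j := by
      rw [transpose_nonsing_inv, transpose_transpose, nonsing_inv_nonsing_inv _
        (isUnit_iff_ne_zero.2 (det_ringTransformation_ne_zero hx hab hG j))]
    rw [ringTransformation, Matrix.mul_inv_rev, transpose_mul, hW,
      transpose_nonsing_inv (S (a _)), (hx.symm _).eq]

lemma lineRing_eq_conicPoint (hx : IsHalfStepSequence m S x)
    (hab : IsTrivialCelestialSymbol m a b) (hG : G.det ≠ 0) {P : ZMod m → Plane F}
    (hP : ∀ n : ℤ, P n = conicPoint G hG (x (2 * n))) (j : ℕ) (n : ℤ) :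
    lineRing a b P j n =
      conicPoint ((ringTransformation S a b G j)⁻¹ᵀ * S (a (Fin.ofNat k j)))
        (det_inv_transpose_mul_ne_zero (det_ringTransformation_ne_zero hx hab hG j)
          (hx.det_ne_zero (hab.a_pos _) (hab.a_lt _)))
        (x (2 * n + ringShift a b j + a (Fin.ofNat k j))) := by
  classical
  have h := pointRing_eq_conicPoint hx hab hG hP j (n + (a (Fin.ofNat k j) : ℤ))
  push_cast at h
  rw [lineRing, joins, pointRing_eq_conicPoint hx hab hG hP j n, h, cross_comm]
  exact hx.cross_eq (hab.a_pos _) (hab.a_lt _) (by ring) (by ring)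

lemma pointRing_self (hx : IsHalfStepSequence m S x) [CharZero F]
    (hab : IsTrivialCelestialSymbol m a b) (hG : G.det ≠ 0) {P : ZMod m → Plane F}
    (hP : ∀ n : ℤ, P n = conicPoint G hG (x (2 * n))) : pointRing a b P k = P := by
  funext n
  obtain ⟨n, rfl⟩ := ZMod.intCast_surjective n
  rw [pointRing_eq_conicPoint hx hab hG hP, hP]
  exact conicPoint_congr (ringTransformation_self hx hab) (by rw [ringShift_self hab, add_zero])

lemma ofNat_val_succ (j : Fin k) : Fin.ofNat k (j.val + 1) = j + 1 := by
  ext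
  simp [Fin.val_add]

lemma pointRing_succ_eq {P : ZMod m → Plane F} (hP : pointRing a b P k = P) (j : Fin k) :
    pointRing a b P ((j + 1 : Fin k) : ℕ) = pointRing a b P (j + 1) := by
  rw [← ofNat_val_succ]
  rcases (Nat.succ_le_of_lt j.isLt).lt_or_eq with h | h
  · rw [Fin.val_ofNat, Nat.mod_eq_of_lt h]
  · rw [Fin.val_ofNat, show (j : ℕ) + 1 = k from h, Nat.mod_self, hP]
    rfl

lemma lineRing_succ_eq {P : ZMod m → Plane F} (hP : pointRing a b P k = P) (j : Fin k) :
    lineRing a b P ((j + 1 : Fin k) : ℕ) = lineRing a b P (j + 1) := by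
  rw [lineRing, lineRing, pointRing_succ_eq hP, ofNat_val_succ]
  congr 2
  ext
  simp

/-- The four points of a line, and the four lines through a point, are distinct because the
corresponding terms of the half-step sequence are. -/
lemma isCelestialConfiguration_of_halfStep (hx : IsHalfStepSequence m S x) [CharZero F]
    (hab : IsTrivialCelestialSymbol m a b) (hG : G.det ≠ 0) {P : ZMod m → Plane F}
    (hP : ∀ n : ℤ, P n = conicPoint G hG (x (2 * n))) :
    IsCelestialConfiguration a b
      (fun j => pointRing a b P j) (fun j => lineRing a b P j) := by
  classical
  have hself := pointRing_self hx hab hG hP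
  have hpt := pointRing_eq_conicPoint hx hab hG hP
  have hln := lineRing_eq_conicPoint hx hab hG hP
  have hof : ∀ j : Fin k, Fin.ofNat k j = j := fun j => by ext; simp
  have hpinj : ∀ j, Function.Injective (pointRing a b P j) := by
    intro j n n' h
    obtain ⟨n, rfl⟩ := ZMod.intCast_surjective n
    obtain ⟨n', rfl⟩ := ZMod.intCast_surjective n'
    rw [hpt, hpt, conicPoint_inj, show 2 * n' + ringShift a b j =
      2 * n + ringShift a b j + 2 * (n' - n) by ring, hx.period] at h
    exact ((ZMod.intCast_eq_intCast_iff_dvd_sub _ _ _).2 h)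
  have hlinj : ∀ j, Function.Injective (lineRing a b P j) := by
    intro j n n' h
    obtain ⟨n, rfl⟩ := ZMod.intCast_surjective n
    obtain ⟨n', rfl⟩ := ZMod.intCast_surjective n'
    rw [hln, hln, conicPoint_inj, show 2 * n' + ringShift a b j + (a (Fin.ofNat k j) : ℤ) =
      2 * n + ringShift a b j + a (Fin.ofNat k j) + 2 * (n' - n) by ring, hx.period] at h
    exact ((ZMod.intCast_eq_intCast_iff_dvd_sub _ _ _).2 h)
  have hcast : ∀ i : ℕ, 0 < i → 2 * i < m → (i : ZMod m) ≠ 0 := fun i hi him =>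
    natCast_zmod_ne_zero hi (by omega)
  have hshift : ∀ i : ℕ, 0 < i → 2 * i < m → ∀ n : ZMod m, n ≠ n + i := by
    intro i hi him n h
    exact hcast i hi him (by simpa using h)
  have hshift' : ∀ i : ℕ, 0 < i → 2 * i < m → ∀ n : ZMod m, n ≠ n - i :=
    fun i hi him n h => hcast i hi him (sub_eq_self.1 h.symm)
  have hlr : ∀ j n, lineRing a b P j n =
      (pointRing a b P j n).cross (pointRing a b P j (n + (a (Fin.ofNat k j) : ZMod m))) :=
    fun j n => rfl
  have hpr : ∀ j n, pointRing a b P (j + 1) n =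
      (lineRing a b P j n).cross (lineRing a b P j (n - (b (Fin.ofNat k j) : ZMod m))) :=
    fun j n => rfl
  have hpne : ∀ j n, pointRing a b P j n ≠
      pointRing a b P j (n + (a (Fin.ofNat k j) : ZMod m)) := fun j n h =>
    hshift _ (hab.a_pos _) (hab.a_lt _) n (hpinj j h)
  have hlne : ∀ j n, lineRing a b P j n ≠
      lineRing a b P j (n - (b (Fin.ofNat k j) : ZMod m)) := fun j n h =>
    hshift' _ (hab.b_pos _) (hab.b_lt _) n (hlinj j h)
  have hdet := det_ringTransformation_ne_zero hx hab hG
  have hSa : ∀ j, IsUnit (S (a j)).det := fun j =>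
    isUnit_iff_ne_zero.2 (hx.det_ne_zero (hab.a_pos _) (hab.a_lt _))
  have hSb : ∀ j, IsUnit (S (b j)).det := fun j =>
    isUnit_iff_ne_zero.2 (hx.det_ne_zero (hab.b_pos _) (hab.b_lt _))
  have hSadet : ∀ j, (S (a j))⁻¹.det ≠ 0 := fun j => by
    rw [det_nonsing_inv, Ring.inverse_eq_inv']
    exact inv_ne_zero (hSa j).ne_zero
  -- Two rings which are adjacent in the construction have no point in common on the same line.
  have hpp : ∀ (j : ℕ) (n n' : ℤ) (κ ε δ : ℤ), (ε = 1 ∨ ε = -1) → (δ = 1 ∨ δ = -1) →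
      2 * n + ringShift a b j = κ + ε * a (Fin.ofNat k j) →
      2 * n' + ringShift a b (j + 1) = κ + δ * b (Fin.ofNat k j) →
      pointRing a b P j n ≠ pointRing a b P (j + 1) n' := by
    intro j n n' κ ε δ hε hδ h1 h2
    have hM : ringTransformation S a b G j =
        ringTransformation S a b G j * (S (a (Fin.ofNat k j)))⁻¹ * S (a (Fin.ofNat k j)) := by
      rw [mul_assoc, nonsing_inv_mul _ (hSa _), mul_one]
    rw [hpt, hpt]
    rw [conicPoint_congr (hM' := by rw [← hM]; exact hdet j) hM rfl]
    exact hx.conicPoint_ne (hab.b_pos _) (hab.a_lt _) (hab.b_lt _) (hab.a_ne_b _) hε hδ κ h1 h2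
  -- The dual statement for the lines through a point.
  have hll : ∀ (j : ℕ) (n n' : ℤ) (κ ε δ : ℤ), (ε = 1 ∨ ε = -1) → (δ = 1 ∨ δ = -1) →
      2 * n + ringShift a b j + a (Fin.ofNat k j) = κ + ε * b (Fin.ofNat k j) →
      2 * n' + ringShift a b (j + 1) + a (Fin.ofNat k (j + 1)) =
        κ + δ * a (Fin.ofNat k (j + 1)) →
      b (Fin.ofNat k j) ≠ a (Fin.ofNat k (j + 1)) →
      lineRing a b P j n ≠ lineRing a b P (j + 1) n' := by
    intro j n n' κ ε δ hε hδ h1 h2 hne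
    have hM : (ringTransformation S a b G j)⁻¹ᵀ * S (a (Fin.ofNat k j)) =
        (ringTransformation S a b G (j + 1))⁻¹ᵀ * S (b (Fin.ofNat k j)) := by
      rw [ringTransformation, Matrix.mul_inv_rev, Matrix.mul_inv_rev, transpose_mul, transpose_mul,
        transpose_nonsing_inv (S (b _)), (hx.symm _).eq, nonsing_inv_nonsing_inv _ (hSa _),
        (hx.symm _).eq, mul_assoc, mul_assoc, nonsing_inv_mul _ (hSb _), mul_one]
    rw [hln, hln]
    rw [conicPoint_congr (hM' := by
      rw [← hM]
      exact det_inv_transpose_mul_ne_zero (hdet j) (hSa _).ne_zero) hM rfl]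
    exact hx.conicPoint_ne (hab.a_pos _) (hab.b_lt _) (hab.a_lt _) hne hε hδ κ h1 h2
  refine ⟨fun j => hpinj j, fun j => hlinj j, fun j n => ?_, fun j n => ?_, fun j n => ?_,
    fun j n => ?_, fun j n => ?_, fun j n => ?_⟩
  · rw [hlr]
    exact orthogonal_cross_left (hpne _ _)
  · have := hpne j n
    rw [hlr]
    rw [hof] at this ⊢
    exact orthogonal_cross_right this
  · rw [pointRing_succ_eq hself, hpr]
    exact cross_orthogonal_left (hlne _ _)
  · have := hlne j (n + (b j : ZMod m))
    rw [pointRing_succ_eq hself, hpr]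
    rw [hof] at this ⊢
    have h := cross_orthogonal_right this
    rw [add_sub_cancel_right] at h ⊢
    exact h
  · rw [pointRing_succ_eq hself]
    obtain ⟨n, rfl⟩ := ZMod.intCast_surjective n
    have e1 : (n : ZMod m) + (a j : ZMod m) = ((n + a j : ℤ) : ZMod m) := by push_cast; rfl
    have e2 : (n : ZMod m) + (b j : ZMod m) = ((n + b j : ℤ) : ZMod m) := by push_cast; rfl
    have hs := ringShift_succ a b j
    rw [hof] at hs
    have h12 := fun h => hshift _ (hab.a_pos j) (hab.a_lt j) (n : ZMod m) (hpinj j h)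
    have h34 := fun h => hshift _ (hab.b_pos j) (hab.b_lt j) (n : ZMod m) (hpinj (j + 1) h)
    rw [e1] at h12 ⊢
    rw [e2] at h34 ⊢
    have h13 := hpp j n n (2 * n + ringShift a b j + a j) (-1) (-1) (by simp) (by simp)
      (by rw [hof]; ring) (by rw [hof, hs]; ring)
    have h14 := hpp j n (n + b j) (2 * n + ringShift a b j + a j) (-1) 1 (by simp) (by simp)
      (by rw [hof]; ring) (by rw [hof, hs]; ring)
    have h23 := hpp j (n + a j) n (2 * n + ringShift a b j + a j) 1 (-1) (by simp) (by simp)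
      (by rw [hof]; ring) (by rw [hof, hs]; ring)
    have h24 := hpp j (n + a j) (n + b j) (2 * n + ringShift a b j + a j) 1 1 (by simp) (by simp)
      (by rw [hof]; ring) (by rw [hof, hs]; ring)
    simp only [List.nodup_cons, List.mem_cons, List.not_mem_nil, or_false, not_or, not_false_eq_true,
      List.nodup_nil, and_true]
    exact ⟨⟨h12, h13, h14⟩, ⟨h23, h24⟩, h34⟩
  · rw [lineRing_succ_eq hself]
    obtain ⟨n, rfl⟩ := ZMod.intCast_surjective n
    have e1 : (n : ZMod m) - (b j : ZMod m) = ((n - b j : ℤ) : ZMod m) := by push_cast; rfl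
    have e2 : (n : ZMod m) - (a (j + 1) : ZMod m) = ((n - a (j + 1) : ℤ) : ZMod m) := by
      push_cast; rfl
    have hs := ringShift_succ a b j
    rw [hof] at hs
    have h12 := fun h => hshift' _ (hab.b_pos j) (hab.b_lt j) (n : ZMod m) (hlinj j h)
    have h34 := fun h => hshift' _ (hab.a_pos (j + 1)) (hab.a_lt (j + 1)) (n : ZMod m)
      (hlinj (j + 1) h)
    rw [e1] at h12 ⊢
    rw [e2] at h34 ⊢
    have hne : b (Fin.ofNat k j) ≠ a (Fin.ofNat k (j + 1)) := by
      rw [hof, ofNat_val_succ]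
      exact hab.b_ne_a j
    have h13 := hll j n n (2 * n + ringShift a b (j + 1)) 1 1 (by simp) (by simp)
      (by rw [hof, hs]; ring) (by ring) hne
    have h14 := hll j n (n - a (j + 1)) (2 * n + ringShift a b (j + 1)) 1 (-1) (by simp) (by simp)
      (by rw [hof, hs]; ring) (by rw [ofNat_val_succ]; ring) hne
    have h23 := hll j (n - b j) n (2 * n + ringShift a b (j + 1)) (-1) 1 (by simp) (by simp)
      (by rw [hof, hs]; ring) (by ring) hne
    have h24 := hll j (n - b j) (n - a (j + 1)) (2 * n + ringShift a b (j + 1)) (-1) (-1)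
      (by simp) (by simp) (by rw [hof, hs]; ring) (by rw [ofNat_val_succ]; ring) hne
    simp only [List.nodup_cons, List.mem_cons, List.not_mem_nil, or_false, not_or, not_false_eq_true,
      List.nodup_nil, and_true]
    exact ⟨⟨h12, h13, h14⟩, ⟨h23, h24⟩, h34⟩

end Closing

/-! ### Descent from the algebraic closure -/

section BaseChange

open Matrix Projectivization

variable {K L : Type*} [Field K] [Field L] (σ : K →+* L)

/-- Homogeneous coordinates in a larger field, as a semilinear map. -/
def baseChangeCoords : (Fin 3 → K) →ₛₗ[σ] (Fin 3 → L) where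
  toFun v := σ ∘ v
  map_add' v w := by ext; simp
  map_smul' c v := by ext; simp

lemma baseChangeCoords_injective : Function.Injective (baseChangeCoords σ) := fun v w h => by
  ext i
  exact σ.injective (congrFun h i)

/-- A point of the projective plane, regarded over a larger field. -/
def baseChange : Plane K → Plane L :=
  Projectivization.map (baseChangeCoords σ) (baseChangeCoords_injective σ)

lemma comp_ne_zero {v : Fin 3 → K} (hv : v ≠ 0) : (σ ∘ v : Fin 3 → L) ≠ 0 := fun h =>
  hv (baseChangeCoords_injective σ (h.trans (map_zero (baseChangeCoords σ)).symm))

lemma baseChange_mk {v : Fin 3 → K} (hv : v ≠ 0) :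
    baseChange σ (mk K v hv) = mk L (σ ∘ v) (comp_ne_zero σ hv) := rfl

lemma comp_crossProduct (v w : Fin 3 → K) :
    (σ ∘ crossProduct v w : Fin 3 → L) = crossProduct (σ ∘ v) (σ ∘ w) := by
  ext i
  fin_cases i <;> simp [cross_apply]

lemma baseChange_injective : Function.Injective (baseChange σ) := fun p q h => by
  induction p using Projectivization.ind with | h v hv =>
  induction q using Projectivization.ind with | h w hw =>
  rw [baseChange_mk, baseChange_mk, mk_eq_mk_iff_crossProduct_eq_zero, ← comp_crossProduct] at h
  rw [mk_eq_mk_iff_crossProduct_eq_zero]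
  by_contra h0
  exact comp_ne_zero σ h0 h

lemma orthogonal_baseChange {p q : Plane K} :
    (baseChange σ p).orthogonal (baseChange σ q) ↔ p.orthogonal q := by
  induction p using Projectivization.ind with | h v hv =>
  induction q using Projectivization.ind with | h w hw =>
  rw [baseChange_mk, baseChange_mk, orthogonal_mk, orthogonal_mk, ← σ.map_dotProduct,
    map_eq_zero_iff _ σ.injective]

lemma baseChange_cross [DecidableEq K] [DecidableEq L] (p q : Plane K) :
    baseChange σ (p.cross q) = (baseChange σ p).cross (baseChange σ q) := by
  by_cases hpq : p = q
  · rw [hpq, Projectivization.cross_self, Projectivization.cross_self]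
  · have hpq' := (baseChange_injective σ).ne hpq
    induction p using Projectivization.ind with | h v hv =>
    induction q using Projectivization.ind with | h w hw =>
    simp only [baseChange_mk] at hpq' ⊢
    rw [cross_mk_of_ne _ _ hpq, cross_mk_of_ne _ _ hpq', baseChange_mk]
    congr 1
    exact comp_crossProduct σ v w

lemma isConic_map {A : Matrix (Fin 3) (Fin 3) K} (hA : IsConic A) : IsConic (A.map σ) := by
  refine ⟨hA.1.map σ, ?_⟩
  have : (A.map σ).det = σ A.det := (σ.map_det A).symm
  rw [this]
  exact (map_ne_zero σ).2 hA.2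

lemma map_mulVec_comp (A : Matrix (Fin 3) (Fin 3) K) (v : Fin 3 → K) :
    (A.map σ) *ᵥ (σ ∘ v) = σ ∘ (A *ᵥ v) := by
  ext i
  exact (σ.map_mulVec A v i).symm

lemma onConic_baseChange {A : Matrix (Fin 3) (Fin 3) K} {p : Plane K} (h : OnConic A p) :
    OnConic (A.map σ) (baseChange σ p) := by
  induction p using Projectivization.ind with | h v hv =>
  rw [onConic_mk] at h
  rw [baseChange_mk, onConic_mk, map_mulVec_comp, ← σ.map_dotProduct, h, map_zero]

lemma isTangent_baseChange {A : Matrix (Fin 3) (Fin 3) K} {l : Plane K} (h : IsTangent A l) :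
    IsTangent (A.map σ) (baseChange σ l) := by
  induction l using Projectivization.ind with | h v hv =>
  obtain ⟨q, hq, hqv⟩ := (isTangent_mk_iff hv).1 h
  rw [baseChange_mk, isTangent_mk_iff]
  exact ⟨σ ∘ q, by rw [map_mulVec_comp, hq], by rw [← σ.map_dotProduct, hqv, map_zero]⟩

variable {m k : ℕ}

lemma joins_baseChange (i : ℕ) (P : ZMod m → Plane K) :
    joins i (fun n => baseChange σ (P n)) = fun n => baseChange σ (joins i P n) := by
  classical
  funext n
  exact (baseChange_cross σ _ _).symm

lemma meets_baseChange (i : ℕ) (P : ZMod m → Plane K) :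
    meets i (fun n => baseChange σ (P n)) = fun n => baseChange σ (meets i P n) := by
  classical
  funext n
  exact (baseChange_cross σ _ _).symm

lemma isPonceletPolygon_baseChange {P : ZMod m → Plane K} (hP : IsPonceletPolygon P) :
    IsPonceletPolygon fun n => baseChange σ (P n) := by
  obtain ⟨hm, hinj, A, B, hA, hB, hPA, hPB⟩ := hP
  refine ⟨hm, (baseChange_injective σ).comp hinj, A.map σ, B.map σ, isConic_map σ hA,
    isConic_map σ hB, fun n => onConic_baseChange σ (hPA n), fun n => ?_⟩
  rw [joins_baseChange]
  exact isTangent_baseChange σ (hPB n)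

variable [NeZero k] {a b : Fin k → ℕ}

lemma pointRing_baseChange (P : ZMod m → Plane K) (j : ℕ) :
    pointRing a b (fun n => baseChange σ (P n)) j =
      fun n => baseChange σ (pointRing a b P j n) := by
  induction j with
  | zero => rfl
  | succ j ih => rw [pointRing, ih, joins_baseChange, meets_baseChange, pointRing]

lemma lineRing_baseChange (P : ZMod m → Plane K) (j : ℕ) :
    lineRing a b (fun n => baseChange σ (P n)) j =
      fun n => baseChange σ (lineRing a b P j n) := by
  rw [lineRing, pointRing_baseChange, joins_baseChange]
  rfl

lemma isCelestialConfiguration_of_baseChange {P L : Fin k → ZMod m → Plane K}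
    (h : IsCelestialConfiguration a b (fun j n => baseChange σ (P j n))
      (fun j n => baseChange σ (L j n))) : IsCelestialConfiguration a b P L where
  point_injective j _ _ e := h.point_injective j (congrArg (baseChange σ) e)
  line_injective j _ _ e := h.line_injective j (congrArg (baseChange σ) e)
  mem₁ j n := (orthogonal_baseChange σ).1 (h.mem₁ j n)
  mem₂ j n := (orthogonal_baseChange σ).1 (h.mem₂ j n)
  mem₃ j n := (orthogonal_baseChange σ).1 (h.mem₃ j n)
  mem₄ j n := (orthogonal_baseChange σ).1 (h.mem₄ j n)
  four_points j n := List.Nodup.of_map (baseChange σ) (h.four_points j n)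
  four_lines j n := List.Nodup.of_map (baseChange σ) (h.four_lines j n)

variable {P : ZMod m → Plane K}

lemma pointRing_self_and_isCelestialConfiguration [CharZero K]
    (hP : IsPonceletPolygon P) (hab : IsTrivialCelestialSymbol m a b) :
    pointRing a b P k = P ∧
      IsCelestialConfiguration a b (fun j => pointRing a b P j) (fun j => lineRing a b P j) := by
  set σ := algebraMap K (AlgebraicClosure K) with hσ
  obtain ⟨G, x, hG, ⟨S, hS, hcomm, hmap⟩, hPx, hper⟩ :=
    (isPonceletPolygon_baseChange σ hP).exists_halfStep
  have hx : IsHalfStepSequence m S x := ⟨hS, hcomm, hmap, hper⟩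
  have hPx' : ∀ n : ℤ, baseChange σ (P n) = conicPoint G hG (x (2 * n)) := fun n => (hPx n).2
  refine ⟨?_, isCelestialConfiguration_of_baseChange σ ?_⟩
  · funext n
    apply baseChange_injective σ
    have := congrFun (pointRing_self (P := fun n => baseChange σ (P n)) hx hab hG hPx') n
    rwa [pointRing_baseChange] at this
  · have := isCelestialConfiguration_of_halfStep (P := fun n => baseChange σ (P n)) hx hab hG hPx'
    simp only [pointRing_baseChange, lineRing_baseChange] at this
    exact this

end BaseChange

/-! ### Infinitesimal deformations of Poncelet polygons -/

section Deformations

open Matrix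

variable {K : Type*} [Field K] {m : ℕ}

/-- The `n`-th side of the polygon with parameters `x` on the standard conic. -/
def side (x : ZMod m → K) (n : ZMod m) : Fin 3 → K := chord (x n) (x (n + 1))

/-- For a polygon circumscribed about the dual conic `Ψ`, the derivative of the tangency condition
for the `n`-th side with respect to the parameter of the end point of this side. -/
def slope (x : ZMod m → K) (Ψ : Matrix (Fin 3) (Fin 3) K) (n : ZMod m) : K :=
  2 * (x n * (Ψ *ᵥ side x n) 0 - (Ψ *ᵥ side x n) 1)

/-- The parameters `x` are those of a polygon on the standard conic whose sides are tangent to the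
conic dual to `Ψ`. -/
structure IsCircumscribed (x : ZMod m → K) (Ψ : Matrix (Fin 3) (Fin 3) K) : Prop where
  injective : Function.Injective x
  isConic : IsConic Ψ
  tangent : ∀ n, side x n ⬝ᵥ Ψ *ᵥ side x n = 0

variable {x : ZMod m → K} {Ψ : Matrix (Fin 3) (Fin 3) K}

lemma add_ne_add (hm : 5 ≤ m) (r : ZMod m) {i j : ℕ} (hij : i ≠ j) (h : i < j + 5)
    (h' : j < i + 5) :
    r + i ≠ r + j := by
  intro e
  rcases Nat.lt_or_gt_of_ne hij with h1 | h1
  · apply natCast_zmod_ne_zero (i := j - i) (by omega) (by omega : j - i < m)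
    rw [Nat.cast_sub h1.le]
    linear_combination -e
  · apply natCast_zmod_ne_zero (i := i - j) (by omega) (by omega : i - j < m)
    rw [Nat.cast_sub h1.le]
    linear_combination e

/-- The tangency condition for the sides at a vertex is a quadratic equation for their other end
points, whose derivatives at the two solutions are opposite. -/
lemma IsCircumscribed.slope_succ (h : IsCircumscribed x Ψ) (hm : 5 ≤ m) (n : ZMod m) :
    2 * (x (n + 1) * (Ψ *ᵥ side x n) 0 - (Ψ *ᵥ side x n) 1) = -slope x Ψ (n + 1) := by
  have hne : x n - x (n + 1 + 1) ≠ 0 := by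
    refine sub_ne_zero.2 (h.injective.ne ?_)
    have := add_ne_add hm n (i := 0) (j := 2) (by simp) (by simp) (by simp)
    rw [add_assoc, one_add_one_eq_two]
    simpa using this
  have h1 := h.tangent n
  have h2 := h.tangent (n + 1)
  have h01 : Ψ 1 0 = Ψ 0 1 := h.isConic.1.apply 0 1
  have h02 : Ψ 2 0 = Ψ 0 2 := h.isConic.1.apply 0 2
  have h12 : Ψ 2 1 = Ψ 1 2 := h.isConic.1.apply 1 2
  rw [eq_neg_iff_add_eq_zero]
  refine (mul_eq_zero.1 ?_).resolve_left hne
  simp [slope, side, chord, mulVec, dotProduct, Fin.sum_univ_three, h01, h02, h12,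
    -mul_eq_zero] at h1 h2 ⊢
  linear_combination 2 * h1 - 2 * h2

/-- No side touches the second conic in a vertex. -/
lemma IsCircumscribed.slope_ne_zero [CharZero K] (h : IsCircumscribed x Ψ) (hm : 5 ≤ m)
    (n : ZMod m) :
    slope x Ψ n ≠ 0 := by
  intro h0
  set w := Ψ *ᵥ side x n with hw
  have h1 : w 1 = x n * w 0 := by
    rw [slope, mul_eq_zero, or_iff_right two_ne_zero, sub_eq_zero] at h0
    exact h0.symm
  have h2 : w 2 = x n * w 1 := by
    have := h.tangent n
    rw [← hw] at this
    simp [side, chord, dotProduct, Fin.sum_univ_three] at this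
    linear_combination this + x (n + 1) * h1
  have hprev : side x (n - 1) ⬝ᵥ w = 0 := by
    simp [side, chord, dotProduct, Fin.sum_univ_three]
    linear_combination h2 - x (n - 1) * h1
  have hside : ∀ n, side x n ≠ 0 := fun n => chord_ne_zero _ _
  obtain ⟨c, hc⟩ := exists_smul_of_isotropic h.isConic (hside n) (h.tangent n)
    (h.tangent (n - 1)) hprev
  have hne1 := add_ne_add hm (n - 1) (i := 0) (j := 1) (by simp) (by simp) (by simp)
  have hne2 := add_ne_add hm (n - 1) (i := 0) (j := 2) (by simp) (by simp) (by simp)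
  push_cast at hne1 hne2
  rw [add_zero] at hne1 hne2
  rcases chord_inj hc with ⟨h3, -⟩ | ⟨h3, -⟩
  · apply hne1
    linear_combination h.injective h3
  · apply hne2
    linear_combination h.injective h3

/-- The quadratic form on lines for which the slopes at both ends of each side cancel. -/
lemma IsCircumscribed.exists_obstruction [CharZero K] (h : IsCircumscribed x Ψ) (hm : 5 ≤ m) :
    ∃ H : Matrix (Fin 3) (Fin 3) K, ∀ n,
      side x n ⬝ᵥ H *ᵥ side x n = slope x Ψ n * slope x Ψ (n + 1) := by
  refine ⟨(-2 : K) • (Ψ * stdConic * Ψ), fun n => ?_⟩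
  have h1 := h.tangent n
  have h2 := h.slope_succ hm n
  have h3 : side x n ⬝ᵥ (Ψ * stdConic * Ψ) *ᵥ side x n =
      (Ψ *ᵥ side x n) ⬝ᵥ stdConic *ᵥ (Ψ *ᵥ side x n) := by
    rw [dotProduct_congr_mulVec, h.isConic.1.eq]
  rw [smul_mulVec, dotProduct_smul, h3, ← neg_eq_iff_eq_neg.2 h2, slope]
  generalize Ψ *ᵥ side x n = w at h1
  simp [side, chord, stdConic, mulVec, dotProduct, Fin.sum_univ_three] at h1 ⊢
  linear_combination -4 * w 0 * h1

/-- The value of a quadratic form on the lines of the plane at the `n`-th side. -/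
def sideForm (x : ZMod m → K) (n : ZMod m) : Matrix (Fin 3) (Fin 3) K →ₗ[K] K where
  toFun H := side x n ⬝ᵥ H *ᵥ side x n
  map_add' H H' := by rw [add_mulVec, dotProduct_add]
  map_smul' c H := by rw [smul_mulVec, dotProduct_smul]; rfl

lemma sideForm_apply (x : ZMod m → K) (n : ZMod m) (H : Matrix (Fin 3) (Fin 3) K) :
    sideForm x n H = side x n ⬝ᵥ H *ᵥ side x n := rfl

/-- The product of the two pencils of lines at two vertices, as a quadratic form on lines. -/
def pencils (x : ZMod m → K) (i j : ZMod m) : Matrix (Fin 3) (Fin 3) K :=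
  vecMulVec (veronese (x i)) (veronese (x j))

lemma sideForm_pencils (x : ZMod m → K) (i j n : ZMod m) :
    sideForm x n (pencils x i j) =
      ((x i - x n) * (x i - x (n + 1))) * ((x j - x n) * (x j - x (n + 1))) := by
  rw [sideForm_apply, pencils, vecMulVec_mulVec, side, ← veronese_dotProduct_chord,
    ← veronese_dotProduct_chord, dotProduct_smul, dotProduct_comm (chord _ _)]
  simp

lemma sideForm_pencils_ne_zero (hx : Function.Injective x) {i j n : ZMod m} (h1 : i ≠ n)
    (h2 : i ≠ n + 1) (h3 : j ≠ n) (h4 : j ≠ n + 1) : sideForm x n (pencils x i j) ≠ 0 := by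
  rw [sideForm_pencils]
  exact mul_ne_zero
    (mul_ne_zero (sub_ne_zero.2 (hx.ne h1)) (sub_ne_zero.2 (hx.ne h2)))
    (mul_ne_zero (sub_ne_zero.2 (hx.ne h3)) (sub_ne_zero.2 (hx.ne h4)))

/-- The form vanishes at none of the sides without the two vertices: as `m ≥ 5`, indices which
differ by less than `5` may be compared before reduction modulo `m`. -/
lemma sideForm_pencils_add_ne_zero (hm : 5 ≤ m) (hx : Function.Injective x) (r : ZMod m)
    {i j n : ℕ} (h1 : i < n + 5 ∧ i ≠ n ∧ i ≠ n + 1 ∧ n + 1 < i + 5)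
    (h2 : j < n + 5 ∧ j ≠ n ∧ j ≠ n + 1 ∧ n + 1 < j + 5) :
    sideForm x (r + n) (pencils x (r + i) (r + j)) ≠ 0 := by
  have hn : r + (n : ZMod m) + 1 = r + ((n + 1 : ℕ) : ZMod m) := by push_cast; ring
  apply sideForm_pencils_ne_zero hx
  · exact add_ne_add hm r (by omega) (by omega) (by omega)
  · rw [hn]; exact add_ne_add hm r (by omega) (by omega) (by omega)
  · exact add_ne_add hm r (by omega) (by omega) (by omega)
  · rw [hn]; exact add_ne_add hm r (by omega) (by omega) (by omega)

lemma sideForm_pencils_add_eq_zero (x : ZMod m → K) (r : ZMod m) {i j n : ℕ}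
    (h : i = n ∨ i = n + 1 ∨ j = n ∨ j = n + 1) :
    sideForm x (r + n) (pencils x (r + i) (r + j)) = 0 := by
  have hn : r + (n : ZMod m) + 1 = r + ((n + 1 : ℕ) : ZMod m) := by push_cast; ring
  rw [sideForm_pencils, hn]
  rcases h with rfl | rfl | rfl | rfl <;> simp

variable [NeZero m]

/-- The obstruction to varying the parameters of the vertices such that the sides remain tangent to
a prescribed variation `H` of the second conic. -/
def obstruction (x : ZMod m → K) (Ψ : Matrix (Fin 3) (Fin 3) K) :
    Matrix (Fin 3) (Fin 3) K →ₗ[K] K :=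
  ∑ n, (slope x Ψ n * slope x Ψ (n + 1))⁻¹ • sideForm x n

lemma obstruction_apply (x : ZMod m → K) (Ψ H : Matrix (Fin 3) (Fin 3) K) :
    obstruction x Ψ H = ∑ n, (slope x Ψ n * slope x Ψ (n + 1))⁻¹ * sideForm x n H := by
  simp [obstruction]

lemma sum_range_add (w : ZMod m → K) (r : ZMod m) :
    ∑ i ∈ Finset.range m, w (r + i) = ∑ n, w n := by
  refine Finset.sum_nbij' (fun i => r + i) (fun n => (n - r).val) ?_ ?_ ?_ ?_ ?_
  · simp
  · intro n _
    simpa using ZMod.val_lt _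
  · intro i hi
    simpa using ZMod.val_cast_of_lt (Finset.mem_range.1 hi)
  · simp
  · simp

/-- A cyclic sequence with sum zero is a sequence of differences. -/
lemma exists_sub_eq (w : ZMod m → K) (hw : ∑ n, w n = 0) (r : ZMod m) (c : K) :
    ∃ u : ZMod m → K, u r = c ∧ ∀ n, u (n + 1) - u n = w n := by
  refine ⟨fun n => c + ∑ i ∈ Finset.range (n - r).val, w (r + i), by simp, fun n => ?_⟩
  have h1 : r + ((n - r).val : ZMod m) = n := by simp
  have hsum := Finset.sum_range_succ (fun i : ℕ => w (r + i)) (n - r).val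
  rw [h1] at hsum
  rcases Nat.lt_or_ge ((n - r).val + 1) m with h | h
  · have h2 : (n + 1 - r).val = (n - r).val + 1 := by
      rw [← ZMod.val_cast_of_lt h]
      push_cast
      rw [ZMod.natCast_val, ZMod.cast_id]
      congr 1
      ring
    simp only [h2, hsum]
    ring
  · have h2 : (n - r).val + 1 = m := by
      have := ZMod.val_lt (n - r)
      omega
    have h3 : n + 1 - r = 0 := by
      have : (((n - r).val + 1 : ℕ) : ZMod m) = 0 := by rw [h2]; simp
      push_cast at this
      rw [ZMod.natCast_val, ZMod.cast_id] at this
      linear_combination this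
    rw [h2, sum_range_add, hw] at hsum
    simp only [h3, ZMod.val_zero, Finset.range_zero, Finset.sum_empty]
    linear_combination hsum

/-- The linearization of the tangency conditions: `δ` is a variation of the parameters of the
vertices, `H` one of the dual conic. -/
def linearizedTangency (x : ZMod m → K) (Ψ : Matrix (Fin 3) (Fin 3) K) (δ : ZMod m → K)
    (H : Matrix (Fin 3) (Fin 3) K) (n : ZMod m) : K :=
  slope x Ψ n * δ (n + 1) - slope x Ψ (n + 1) * δ n + sideForm x n H

lemma IsCircumscribed.exists_linearizedTangency_eq [CharZero K] (h : IsCircumscribed x Ψ)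
    (hm : 5 ≤ m)
    {H : Matrix (Fin 3) (Fin 3) K} {t : ZMod m → K}
    (hH : obstruction x Ψ H = ∑ n, (slope x Ψ n * slope x Ψ (n + 1))⁻¹ * t n)
    (r : ZMod m) (c : K) :
    ∃ δ : ZMod m → K, δ r = c ∧ linearizedTangency x Ψ δ H = t := by
  have hs := h.slope_ne_zero hm
  obtain ⟨u, hur, hu⟩ := exists_sub_eq
    (fun n => (slope x Ψ n * slope x Ψ (n + 1))⁻¹ * (t n - sideForm x n H))
    (by simp only [mul_sub, Finset.sum_sub_distrib, ← hH, obstruction_apply, sub_self]) r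
    ((slope x Ψ r)⁻¹ * c)
  refine ⟨fun n => slope x Ψ n * u n, ?_, funext fun n => ?_⟩
  · simp only [hur, mul_inv_cancel_left₀ (hs r)]
  · have h1 := hu n
    rw [eq_inv_mul_iff_mul_eq₀ (mul_ne_zero (hs n) (hs (n + 1)))] at h1
    rw [linearizedTangency]
    linear_combination h1

/-- If the obstruction vanished on all forms which are zero on three consecutive sides, it would
vanish identically. -/
lemma IsCircumscribed.exists_obstruction_ne_zero [CharZero K] (h : IsCircumscribed x Ψ)
    (hm : 5 ≤ m) :
    ∃ (r : ZMod m) (H : Matrix (Fin 3) (Fin 3) K), sideForm x r H = 0 ∧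
      sideForm x (r + 1) H = 0 ∧ sideForm x (r + 2) H = 0 ∧ obstruction x Ψ H ≠ 0 := by
  by_contra! hcon
  obtain ⟨H, hH⟩ := h.exists_obstruction hm
  have hH1 : obstruction x Ψ H ≠ 0 := by
    rw [obstruction_apply]
    simp only [sideForm_apply, hH]
    rw [Finset.sum_congr rfl fun n _ => inv_mul_cancel₀
      (mul_ne_zero (h.slope_ne_zero hm n) (h.slope_ne_zero hm (n + 1)))]
    simp [NeZero.ne m]
  have hcon' : ∀ (i : ℕ) (H : Matrix (Fin 3) (Fin 3) K), sideForm x (0 + (i : ℕ)) H = 0 →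
      sideForm x (0 + (i + 1 : ℕ)) H = 0 → sideForm x (0 + (i + 2 : ℕ)) H = 0 →
      obstruction x Ψ H = 0 := fun i H h1 h2 h3 =>
    hcon (0 + (i : ℕ)) H h1 (by rw [← h2]; push_cast; rw [add_assoc])
      (by rw [← h3]; push_cast; rw [add_assoc])
  -- Correct the values of `H` at the sides with indices `2`, `1` and `3`, in this order.
  have hE := fun (i j n : ℕ) hijn => sideForm_pencils_add_eq_zero x (0 : ZMod m) (i := i) (j := j)
    (n := n) hijn
  have hE' := fun (i j n : ℕ) h1 h2 => sideForm_pencils_add_ne_zero hm h.injective (0 : ZMod m)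
    (i := i) (j := j) (n := n) h1 h2
  have hcorrect : ∀ (n i j : ℕ) (H : Matrix (Fin 3) (Fin 3) K),
      (i < n + 5 ∧ i ≠ n ∧ i ≠ n + 1 ∧ n + 1 < i + 5) →
      (j < n + 5 ∧ j ≠ n ∧ j ≠ n + 1 ∧ n + 1 < j + 5) →
      obstruction x Ψ (pencils x (0 + i) (0 + j)) = 0 →
      ∃ H', obstruction x Ψ H' = obstruction x Ψ H ∧ sideForm x (0 + n) H' = 0 ∧
        ∀ n' : ℕ, (i = n' ∨ i = n' + 1 ∨ j = n' ∨ j = n' + 1) →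
          sideForm x (0 + n') H' = sideForm x (0 + n') H := by
    intro n i j H h1 h2 h0
    refine ⟨H - (sideForm x (0 + n) H / sideForm x (0 + n) (pencils x (0 + i) (0 + j))) •
      pencils x (0 + i) (0 + j), ?_, ?_, fun n' hn' => ?_⟩
    · rw [map_sub, map_smul, h0, smul_zero, sub_zero]
    · rw [map_sub, map_smul, smul_eq_mul, div_mul_cancel₀ _ (hE' i j n h1 h2), sub_self]
    · rw [map_sub, map_smul, hE i j n' hn', smul_zero, sub_zero]
  have hz : ∀ i : ℕ, obstruction x Ψ (pencils x (0 + (i + 1 : ℕ)) (0 + (i + 2 : ℕ))) = 0 :=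
    fun i => hcon' i _ (hE _ _ _ (by omega)) (hE _ _ _ (by omega)) (hE _ _ _ (by omega))
  obtain ⟨H₁, h₁, h₁z, -⟩ := hcorrect 2 4 5 H (by omega) (by omega) (hz 3)
  obtain ⟨H₂, h₂, h₂z, h₂'⟩ := hcorrect 1 3 4 H₁ (by omega) (by omega) (hz 2)
  obtain ⟨H₃, h₃, h₃z, h₃'⟩ := hcorrect 3 1 2 H₂ (by omega) (by omega) (hz 0)
  apply hH1
  rw [← h₁, ← h₂, ← h₃]
  exact hcon' 1 H₃ (by rw [h₃' _ (by omega), h₂z]) (by rw [h₃' _ (by omega), h₂' _ (by omega), h₁z])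
    h₃z

/-- There are four consecutive vertices which may be prescribed freely, whatever the variation of
the tangency conditions. Moreover, with these vertices fixed and tangency maintained, some other
vertex may be varied. -/
lemma IsCircumscribed.exists_variation [CharZero K] (h : IsCircumscribed x Ψ) (hm : 5 ≤ m) :
    ∃ r : ZMod m,
      (∀ (t : ZMod m → K) (d : Fin 4 → K), ∃ δ H, linearizedTangency x Ψ δ H = t ∧
        ∀ s : Fin 4, δ (r + (s : ℕ)) = d s) ∧
      ∃ δ H, linearizedTangency x Ψ δ H = 0 ∧ (∀ s : Fin 4, δ (r + (s : ℕ)) = 0) ∧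
        ∃ n, δ n ≠ 0 := by
  obtain ⟨r, H₀, hr0, hr1, hr2, hr⟩ := h.exists_obstruction_ne_zero hm
  have hs := h.slope_ne_zero hm
  have hE := fun (i j n : ℕ) hijn => sideForm_pencils_add_eq_zero x r (i := i) (j := j)
    (n := n) hijn
  have hE' := fun (i j n : ℕ) h1 h2 => sideForm_pencils_add_ne_zero hm h.injective r
    (i := i) (j := j) (n := n) h1 h2
  have hrz : ∀ n : ℕ, n < 3 → sideForm x (r + n) H₀ = 0 := by
    intro n hn
    interval_cases n
    · simpa using hr0
    · simpa using hr1
    · simpa using hr2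
  have hnext : ∀ n : ℕ, r + (n : ZMod m) + 1 = r + ((n + 1 : ℕ) : ZMod m) := fun n => by
    push_cast; ring
  -- The conditions on `H` under which the four vertices are moved as prescribed.
  have hpres : ∀ (t : ZMod m → K) (d : ℕ → K) (H : Matrix (Fin 3) (Fin 3) K),
      obstruction x Ψ H = ∑ n, (slope x Ψ n * slope x Ψ (n + 1))⁻¹ * t n →
      (∀ n : ℕ, n < 3 → sideForm x (r + n) H = t (r + n) + slope x Ψ (r + (n + 1 : ℕ)) * d n -
        slope x Ψ (r + n) * d (n + 1)) →
      ∃ δ, linearizedTangency x Ψ δ H = t ∧ ∀ s : Fin 4, δ (r + (s : ℕ)) = d s := by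
    intro t d H h1 h2
    obtain ⟨δ, hδ, hlin⟩ := h.exists_linearizedTangency_eq hm h1 r (d 0)
    refine ⟨δ, hlin, ?_⟩
    have hstep : ∀ n : ℕ, n < 3 → δ (r + n) = d n → δ (r + (n + 1 : ℕ)) = d (n + 1) := by
      intro n hn h3
      have h4 := congrFun hlin (r + n)
      rw [linearizedTangency, hnext, h2 n hn, h3] at h4
      apply mul_left_cancel₀ (hs (r + n))
      linear_combination h4
    have h0 : δ (r + (0 : ℕ)) = d 0 := by simpa using hδ
    have h1 := hstep 0 (by simp) h0
    have h2 := hstep 1 (by simp) h1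
    have h3 := hstep 2 (by simp) h2
    intro s
    fin_cases s
    exacts [h0, h1, h2, h3]
  refine ⟨r, fun t d => ?_, ?_⟩
  · obtain ⟨H, hH⟩ : ∃ H : Matrix (Fin 3) (Fin 3) K, ∀ n : ℕ, n < 3 → sideForm x (r + n) H =
        t (r + n) + slope x Ψ (r + (n + 1 : ℕ)) * d (Fin.ofNat 4 n) -
        slope x Ψ (r + n) * d (Fin.ofNat 4 (n + 1)) := by
      generalize hv : (fun n : ℕ => t (r + n) + slope x Ψ (r + (n + 1 : ℕ)) * d (Fin.ofNat 4 n) -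
        slope x Ψ (r + n) * d (Fin.ofNat 4 (n + 1))) = v
      have hv' := fun n => congrFun hv n
      simp only [hv']
      refine ⟨(v 0 / sideForm x (r + (0 : ℕ)) (pencils x (r + (2 : ℕ)) (r + (2 : ℕ)))) •
          pencils x (r + (2 : ℕ)) (r + (2 : ℕ)) +
        (v 1 / sideForm x (r + (1 : ℕ)) (pencils x (r + (0 : ℕ)) (r + (3 : ℕ)))) •
          pencils x (r + (0 : ℕ)) (r + (3 : ℕ)) +
        (v 2 / sideForm x (r + (2 : ℕ)) (pencils x (r + (1 : ℕ)) (r + (1 : ℕ)))) •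
          pencils x (r + (1 : ℕ)) (r + (1 : ℕ)), fun n hn => ?_⟩
      simp only [map_add, map_smul, smul_eq_mul]
      interval_cases n
      · rw [div_mul_cancel₀ _ (hE' 2 2 0 (by omega) (by omega)), hE 0 3 0 (by omega),
          hE 1 1 0 (by omega)]
        ring
      · rw [div_mul_cancel₀ _ (hE' 0 3 1 (by omega) (by omega)), hE 2 2 1 (by omega),
          hE 1 1 1 (by omega)]
        ring
      · rw [div_mul_cancel₀ _ (hE' 1 1 2 (by omega) (by omega)), hE 0 3 2 (by omega),
          hE 2 2 2 (by omega)]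
        ring
    obtain ⟨δ, hδ, hd⟩ := hpres t (fun n => d (Fin.ofNat 4 n))
      (H + ((∑ n, (slope x Ψ n * slope x Ψ (n + 1))⁻¹ * t n - obstruction x Ψ H) /
        obstruction x Ψ H₀) • H₀)
      (by rw [map_add, map_smul, smul_eq_mul, div_mul_cancel₀ _ hr]; ring)
      (fun n hn => by rw [map_add, map_smul, hrz n hn, smul_zero, add_zero, hH n hn])
    refine ⟨δ, _, hδ, fun s => ?_⟩
    rw [hd]
    congr 1
    ext
    simp
  · -- Two independent forms which vanish on the three sides between the fixed vertices.
    set E := pencils x (r + (1 : ℕ)) (r + (2 : ℕ)) with hEdef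
    set E' := pencils x (r + (1 : ℕ)) (r + (3 : ℕ)) with hE'def
    obtain ⟨H, hobs, hz, n, hn⟩ : ∃ H : Matrix (Fin 3) (Fin 3) K, obstruction x Ψ H = 0 ∧
        (∀ n : ℕ, n < 3 → sideForm x (r + n) H = 0) ∧ ∃ n, sideForm x n H ≠ 0 := by
      have hEz : ∀ n : ℕ, n < 3 → sideForm x (r + n) E = 0 ∧ sideForm x (r + n) E' = 0 := fun n hn =>
        ⟨hE _ _ _ (by omega), hE _ _ _ (by omega)⟩
      by_cases h0 : obstruction x Ψ E' = 0
      · exact ⟨E', h0, fun n hn => (hEz n hn).2, _, hE' 1 3 4 (by omega) (by omega)⟩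
      · refine ⟨obstruction x Ψ E' • E - obstruction x Ψ E • E', ?_, fun n hn => ?_,
          r + (3 : ℕ), ?_⟩
        · rw [map_sub, map_smul, map_smul, smul_eq_mul, smul_eq_mul, mul_comm, sub_self]
        · rw [map_sub, map_smul, map_smul, (hEz n hn).1, (hEz n hn).2, smul_zero, smul_zero,
            sub_zero]
        · rw [map_sub, map_smul, map_smul, hE 1 3 3 (by omega), smul_zero, sub_zero]
          exact mul_ne_zero h0 (hE' 1 2 3 (by omega) (by omega))
    obtain ⟨δ, hδ, hd⟩ := hpres 0 0 H (by simp [hobs]) (fun n hn => by simp [hz n hn])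
    refine ⟨δ, H, hδ, hd, ?_⟩
    by_contra! h0
    have := congrFun hδ n
    rw [linearizedTangency, h0, h0] at this
    simp [hn] at this

end Deformations

/-! ### Integration of the infinitesimal deformation -/

section ImplicitFunction

open Filter Topology

variable {𝕜 E F : Type*} [RCLike 𝕜] [NormedAddCommGroup E] [NormedSpace 𝕜 E] [CompleteSpace E]
  [NormedAddCommGroup F] [NormedSpace 𝕜 F] [FiniteDimensional 𝕜 F]

/-- A fiber of a submersion contains a path in the direction of any kernel vector `v` of the
derivative; a linear functional `φ` which does not vanish on `v` detects that the path is not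
constant. -/
lemma exists_path_in_fiber {f : E → F} {f' : E →L[𝕜] F} {a : E} (hf : HasStrictFDerivAt f f' a)
    (hf' : f'.range = ⊤) {v : E} (hv : f' v = 0) {U : Set E} (hU : U ∈ 𝓝 a) (φ : E →L[𝕜] 𝕜)
    (hφ : φ v ≠ 0) :
    ∃ γ : unitInterval → E, Continuous γ ∧ γ 0 = a ∧ (∀ t, γ t ∈ U ∧ f (γ t) = f a) ∧
      ∃ t, φ (γ t) ≠ φ a := by
  set w : f'.ker := ⟨v, hv⟩ with hw
  set g : 𝕜 → E := fun z => hf.implicitFunction f f' hf' (f a) (z • w) with hg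
  have hg0 : g 0 = a := by simp [hg]
  have hline : HasDerivAt (fun z : 𝕜 => z • w) w 0 := by
    simpa using (hasDerivAt_id (0 : 𝕜)).smul_const w
  have hline0 : Tendsto (fun z : 𝕜 => z • w) (𝓝 0) (𝓝 0) := by
    simpa using hline.continuousAt.tendsto
  have hderiv : HasDerivAt (fun z => φ (g z)) (φ v) 0 := by
    have h1 : HasFDerivAt (hf.implicitFunction f f' hf' (f a)) f'.ker.subtypeL ((0 : 𝕜) • w) := by
      rw [zero_smul]
      exact hf.to_implicitFunction hf' |>.hasFDerivAt
    have h2 := h1.comp_hasDerivAt (0 : 𝕜) hline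
    exact φ.hasFDerivAt.comp_hasDerivAt (0 : 𝕜) h2
  have hpair : Tendsto (fun z : 𝕜 => (f a, z • w)) (𝓝 0) (𝓝 (f a, 0)) :=
    tendsto_const_nhds.prodMk_nhds hline0
  have hfib : ∀ᶠ z in 𝓝 (0 : 𝕜), f (g z) = f a :=
    hpair.eventually (hf.map_implicitFunction_eq hf')
  have htarget : ∀ᶠ z in 𝓝 (0 : 𝕜),
      (f a, z • w) ∈ (hf.implicitToOpenPartialHomeomorph f f' hf').target :=
    hpair.eventually ((hf.implicitToOpenPartialHomeomorph f f' hf').open_target.mem_nhds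
      (hf.mem_implicitToOpenPartialHomeomorph_target hf'))
  have hcont : ∀ᶠ z in 𝓝 (0 : 𝕜), ContinuousAt g z := by
    filter_upwards [htarget] with z hz
    exact ((hf.implicitToOpenPartialHomeomorph f f' hf').continuousAt_symm hz).comp
      (f := fun z : 𝕜 => (f a, z • w)) (by fun_prop)
  have hgU : ∀ᶠ z in 𝓝 (0 : 𝕜), g z ∈ U := by
    have := hcont.self_of_nhds
    rw [ContinuousAt, hg0] at this
    exact this hU
  have hne : ∀ᶠ z in 𝓝[≠] (0 : 𝕜), φ (g z) ≠ φ a := hderiv.eventually_ne hφ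
  obtain ⟨ε, hε, hball⟩ := Metric.eventually_nhds_iff.1 (hfib.and (hcont.and hgU))
  obtain ⟨ε', hε', hball'⟩ := Metric.eventually_nhds_iff.1 (eventually_nhdsWithin_iff.1 hne)
  set c : ℝ := min ε ε' / 2 with hc
  have hc0 : 0 < c := by positivity
  have hdist : ∀ t : unitInterval, dist (((c * t : ℝ) : 𝕜)) 0 ≤ c := by
    intro t
    rw [dist_zero_right, RCLike.norm_ofReal, abs_of_nonneg (mul_nonneg hc0.le t.2.1)]
    exact mul_le_of_le_one_right hc0.le t.2.2
  have hcε : c < ε := by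
    have := min_le_left ε ε'
    have := lt_min hε hε'
    linarith
  have hcε' : c < ε' := by
    have := min_le_right ε ε'
    have := lt_min hε hε'
    linarith
  have hgood := fun t : unitInterval => hball ((hdist t).trans_lt hcε)
  refine ⟨fun t => g ((c * t : ℝ) : 𝕜), continuous_iff_continuousAt.2 fun t => ?_, ?_,
    fun t => ⟨(hgood t).2.2, (hgood t).1⟩, 1, ?_⟩
  · exact ContinuousAt.comp (f := fun t : unitInterval => ((c * t : ℝ) : 𝕜)) (hgood t).2.1
      (by fun_prop)
  · simpa using hg0
  · exact hball' ((hdist 1).trans_lt hcε') (by simpa using hc0.ne')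

end ImplicitFunction

section Motions

open Matrix Filter Topology

variable {𝕜 : Type*} [RCLike 𝕜] {m : ℕ}

/-- The tangency conditions for the parameters of a polygon and a dual conic, together with the
parameters of four consecutive vertices. -/
def tangencyMap (r : ZMod m) (p : (ZMod m → 𝕜) × (Fin 3 → Fin 3 → 𝕜)) :
    (ZMod m → 𝕜) × (Fin 4 → 𝕜) :=
  (fun n => side p.1 n ⬝ᵥ of p.2 *ᵥ side p.1 n, fun s => p.1 (r + (s : ℕ)))

lemma contDiff_tangencyMap [NeZero m] (r : ZMod m) : ContDiff 𝕜 1 (tangencyMap (𝕜 := 𝕜) r) := by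
  refine ContDiff.prodMk (contDiff_pi.2 fun n => ?_) (contDiff_pi.2 fun s => ?_)
  · simp only [side, chord, mulVec, dotProduct, Fin.sum_univ_three, of_apply, cons_val_zero,
      cons_val_one, cons_val]
    fun_prop
  · fun_prop

/-- The derivative of the tangency condition for the `n`-th side, in the direction `(δ, H)`. -/
lemma hasDerivAt_tangency {x : ZMod m → 𝕜}
    {Ψ : Matrix (Fin 3) (Fin 3) 𝕜} (hΨ : IsCircumscribed x Ψ) (hm : 5 ≤ m)
    (δ : ZMod m → 𝕜) (H : Matrix (Fin 3) (Fin 3) 𝕜) (n : ZMod m) :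
    HasDerivAt (fun z : 𝕜 => side (x + z • δ) n ⬝ᵥ (Ψ + z • H) *ᵥ side (x + z • δ) n)
      (linearizedTangency x Ψ δ H n) 0 := by
  have hlin : ∀ a b : 𝕜, HasDerivAt (fun z : 𝕜 => a + z * b) b 0 := fun a b => by
    simpa using ((hasDerivAt_id (0 : 𝕜)).mul_const b).const_add a
  have h2 := hΨ.slope_succ hm n
  have h01 : Ψ 1 0 = Ψ 0 1 := hΨ.isConic.1.apply 0 1
  have h02 : Ψ 2 0 = Ψ 0 2 := hΨ.isConic.1.apply 0 2
  have h12 : Ψ 2 1 = Ψ 1 2 := hΨ.isConic.1.apply 1 2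
  have hx := hlin (x n) (δ n)
  have hy := hlin (x (n + 1)) (δ (n + 1))
  have hψ := fun i j => hlin (Ψ i j) (H i j)
  have hl0 := hx.mul hy
  have hl1 := (hx.add hy).neg
  have hw := fun i => (((hψ i 0).mul hl0).add ((hψ i 1).mul hl1)).add (hψ i 2)
  have hall := ((hl0.mul (hw 0)).add (hl1.mul (hw 1))).add (hw 2)
  rw [linearizedTangency, ← neg_eq_iff_eq_neg.2 h2]
  convert! hall using 1
  · funext z
    simp [side, chord, mulVec, dotProduct, Fin.sum_univ_three]
  · simp [slope, sideForm_apply, side, chord, mulVec, dotProduct, Fin.sum_univ_three, h01, h02, h12]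
    ring

/-- A polygon in Poncelet position can be moved, with four consecutive vertices fixed. -/
lemma IsCircumscribed.exists_motion [NeZero m] {x : ZMod m → 𝕜} {Ψ : Matrix (Fin 3) (Fin 3) 𝕜}
    (h : IsCircumscribed x Ψ) (hm : 5 ≤ m) :
    ∃ (r : ZMod m) (y : unitInterval → ZMod m → 𝕜), Continuous y ∧ y 0 = x ∧
      (∀ t, ∃ Ψ', IsCircumscribed (y t) Ψ') ∧ (∀ t (s : Fin 4), y t (r + (s : ℕ)) =
        x (r + (s : ℕ))) ∧ ∃ t n, y t n ≠ x n := by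
  obtain ⟨r, hsurj, δ, H, hlin, hfix, n, hn⟩ := h.exists_variation hm
  set p : (ZMod m → 𝕜) × (Fin 3 → Fin 3 → 𝕜) := (x, Ψ) with hp
  have hf : HasStrictFDerivAt (tangencyMap r) (fderiv 𝕜 (tangencyMap r) p) p :=
    (contDiff_tangencyMap r).contDiffAt.hasStrictFDerivAt one_ne_zero
  have hderiv : ∀ (δ : ZMod m → 𝕜) (H : Fin 3 → Fin 3 → 𝕜),
      fderiv 𝕜 (tangencyMap r) p (δ, H) =
        (linearizedTangency x Ψ δ (of H), fun s : Fin 4 => δ (r + (s : ℕ))) := by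
    intro δ H
    have h1 : HasDerivAt (fun z : 𝕜 => tangencyMap r (p + z • (δ, H)))
        (fderiv 𝕜 (tangencyMap r) p (δ, H)) 0 :=
      hf.hasFDerivAt.hasLineDerivAt (δ, H)
    refine h1.unique (HasDerivAt.prodMk (hasDerivAt_pi.2 fun n => ?_) (hasDerivAt_pi.2 fun s => ?_))
    · exact hasDerivAt_tangency h hm δ (of H) n
    · simpa using ((hasDerivAt_id (0 : 𝕜)).mul_const (δ (r + (s : ℕ)))).const_add
        (x (r + (s : ℕ)))
  have hrange : (fderiv 𝕜 (tangencyMap r) p).range = ⊤ := by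
    rw [LinearMap.range_eq_top]
    rintro ⟨t, d⟩
    obtain ⟨δ, H, h1, h2⟩ := hsurj t d
    exact ⟨(δ, H), (hderiv δ H).trans (Prod.ext h1 (funext h2))⟩
  have hker : fderiv 𝕜 (tangencyMap r) p (δ, H) = 0 :=
    (hderiv δ H).trans (Prod.ext hlin (funext hfix))
  -- Near `p`, the parameters remain different and the symmetric part of the matrix invertible.
  have hU : {q : (ZMod m → 𝕜) × (Fin 3 → Fin 3 → 𝕜) |
      (∀ i j, i ≠ j → q.1 i ≠ q.1 j) ∧ (of q.2 + (of q.2)ᵀ).det ≠ 0} ∈ 𝓝 p := by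
    have hc : Continuous fun q : (ZMod m → 𝕜) × (Fin 3 → Fin 3 → 𝕜) =>
        (of q.2 : Matrix (Fin 3) (Fin 3) 𝕜) := continuous_snd
    refine Eventually.and (eventually_all.2 fun i => eventually_all.2 fun j =>
      eventually_all.2 fun hij => ?_) ?_
    · have hi : ∀ i, ContinuousAt (fun q : (ZMod m → 𝕜) × (Fin 3 → Fin 3 → 𝕜) => q.1 i) p :=
        fun i => by fun_prop
      exact ((hi i).ne_iff_eventually_ne (hi j)).1 (h.injective.ne hij)
    · refine ContinuousAt.eventually_ne (hc.add hc.matrix_transpose).matrix_det.continuousAt ?_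
      have : of p.2 + (of p.2)ᵀ = (2 : 𝕜) • Ψ := by
        rw [two_smul]
        exact congrArg (Ψ + ·) h.isConic.1
      rw [this, det_smul]
      exact mul_ne_zero (by simp) h.isConic.2
  obtain ⟨γ, hγ, hγ0, hγU, t, ht⟩ := exists_path_in_fiber hf hrange hker hU
    ((ContinuousLinearMap.proj (R := 𝕜) (φ := fun _ : ZMod m => 𝕜) n).comp
      (ContinuousLinearMap.fst 𝕜 _ _)) hn
  refine ⟨r, fun t => (γ t).1, continuous_fst.comp hγ, congrArg Prod.fst hγ0, fun t => ?_,
    fun t s => congrFun (congrArg Prod.snd (hγU t).2) s, t, n, ht⟩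
  refine ⟨of (γ t).2 + (of (γ t).2)ᵀ, fun i j hij => ?_, ⟨?_, (hγU t).1.2⟩, fun n => ?_⟩
  · by_contra hne
    exact (hγU t).1.1 i j hne hij
  · rw [IsSymm, transpose_add, transpose_transpose, add_comm]
  · have h1 : side (γ t).1 n ⬝ᵥ of (γ t).2 *ᵥ side (γ t).1 n = 0 :=
      (congrFun (congrArg Prod.fst (hγU t).2) n).trans (h.tangent n)
    rw [add_mulVec, dotProduct_add, h1, mulVec_transpose, dotProduct_comm, ← dotProduct_mulVec, h1,
      add_zero]

end Motions

section Polygons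

open Matrix Projectivization

variable {K : Type*} [Field K] [CharZero K] {m : ℕ}

/-- Conversely to `IsPonceletPolygon.exists_isCircumscribed`, a projective image of a polygon on the
standard conic that is circumscribed about a second conic is a Poncelet polygon. -/
lemma IsCircumscribed.isPonceletPolygon {x : ZMod m → K} {Ψ : Matrix (Fin 3) (Fin 3) K}
    (h : IsCircumscribed x Ψ) (hm : 5 ≤ m) {G : Matrix (Fin 3) (Fin 3) K} (hG : G.det ≠ 0) :
    IsPonceletPolygon fun n => conicPoint G hG (x n) := by
  classical
  have hunit : IsUnit G.det := isUnit_iff_ne_zero.2 hG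
  have hΨunit : IsUnit Ψ.det := isUnit_iff_ne_zero.2 h.isConic.2
  have hdet : ∀ {M : Matrix (Fin 3) (Fin 3) K}, M.det ≠ 0 → M⁻¹.det ≠ 0 := fun {M} hM => by
    rw [det_nonsing_inv, Ring.inverse_eq_inv']
    exact inv_ne_zero hM
  have hGG : ∀ v, G⁻¹ *ᵥ (G *ᵥ v) = v := fun v => by
    rw [mulVec_mulVec, nonsing_inv_mul _ hunit, one_mulVec]
  refine ⟨by omega, fun i j hij => h.injective (conicPoint_inj.1 hij),
    G⁻¹ᵀ * stdConic * G⁻¹, G⁻¹ᵀ * Ψ⁻¹ * G⁻¹, ⟨isSymm_congr ?_ _, det_congr_ne_zero ?_ (hdet hG)⟩,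
    ⟨isSymm_congr ?_ _, det_congr_ne_zero (hdet h.isConic.2) (hdet hG)⟩, fun n => ?_, fun n => ?_⟩
  · ext i j
    fin_cases i <;> fin_cases j <;> rfl
  · rw [det_stdConic]
    norm_num
  · rw [IsSymm, transpose_nonsing_inv, h.isConic.1.eq]
  · beta_reduce
    rw [conicPoint, onConic_mk, ← dotProduct_congr_mulVec, hGG, veronese_isotropic]
  · have hne : x n ≠ x (n + 1) := h.injective.ne (by
      simpa using add_ne_add hm n (i := 0) (j := 1) (by simp) (by simp) (by simp))
    have hne' : conicPoint G hG (x n) ≠ conicPoint G hG (x (n + 1)) := fun h' =>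
      hne (conicPoint_inj.1 h')
    rw [conicPoint, conicPoint] at hne'
    rw [joins, Nat.cast_one, conicPoint, conicPoint, cross_mk_of_ne _ _ hne', isTangent_mk_iff]
    have hcross : crossProduct (G *ᵥ veronese (x n)) (G *ᵥ veronese (x (n + 1))) =
        G⁻¹ᵀ *ᵥ ((G.det * (x (n + 1) - x n)) • side x n) := by
      have hT : IsUnit Gᵀ.det := by rwa [det_transpose]
      rw [← smul_smul, side, ← cross_veronese, ← transpose_mulVec_cross, mulVec_mulVec,
        transpose_nonsing_inv, nonsing_inv_mul _ hT, one_mulVec]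
    rw [hcross]
    generalize G.det * (x (n + 1) - x n) = c
    refine ⟨G *ᵥ (Ψ *ᵥ (c • side x n)), ?_, ?_⟩
    · rw [← mulVec_mulVec, hGG, ← mulVec_mulVec, mulVec_mulVec _ Ψ⁻¹, nonsing_inv_mul _ hΨunit,
        one_mulVec]
    · rw [mulVec_transpose, dotProduct_comm, ← dotProduct_mulVec, hGG, mulVec_smul, dotProduct_smul,
        smul_dotProduct, h.tangent, smul_zero, smul_zero]

/-- A Poncelet polygon in coordinates where its conic is the standard one and has a point which is
not a vertex at infinity. -/
lemma IsPonceletPolygon.exists_isCircumscribed {P : ZMod m → Plane K} (hP : IsPonceletPolygon P) :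
    ∃ (G Ψ : Matrix (Fin 3) (Fin 3) K) (hG : G.det ≠ 0) (x : ZMod m → K),
      IsCircumscribed x Ψ ∧ ∀ n, P n = conicPoint G hG (x n) := by
  classical
  obtain ⟨hm, hinj, A, B, hA, hB, hPA, hPB⟩ := hP
  have : NeZero m := ⟨by omega⟩
  have h1 : (1 : ZMod m) ≠ 0 := by
    exact_mod_cast natCast_zmod_ne_zero one_pos (by omega : 1 < m)
  have hPA' : ∀ n, (P n).rep ⬝ᵥ A *ᵥ (P n).rep = 0 := hPA
  obtain ⟨e, he0, heA, heP⟩ : ∃ (e : Fin 3 → K) (he : e ≠ 0), e ⬝ᵥ A *ᵥ e = 0 ∧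
      ∀ n, P n ≠ mk K e he := by
    obtain ⟨G, hG, -, γ, hγ, hGA⟩ := exists_congr_stdConic hA (P 0).rep_nonzero (hPA' 0)
    have hinf : (Set.range (conicPoint G hG)).Infinite :=
      Set.infinite_range_of_injective fun x y h => conicPoint_inj.1 h
    obtain ⟨-, ⟨x, rfl⟩, hx⟩ := hinf.exists_notMem_finite (Set.finite_range P)
    refine ⟨G *ᵥ veronese x, mulVec_ne_zero hG (veronese_ne_zero x), ?_, fun n hn => hx ⟨n, hn⟩⟩
    rw [dotProduct_congr_mulVec, hGA, smul_mulVec, dotProduct_smul, veronese_isotropic, smul_zero]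
  obtain ⟨G, hG, hGe, γ, hγ, hGA⟩ := exists_congr_stdConic hA he0 heA
  have hunit : IsUnit G.det := isUnit_iff_ne_zero.2 hG
  have hx : ∀ n, ∃ x, P n = conicPoint G hG x := by
    intro n
    have hGu : G *ᵥ (G⁻¹ *ᵥ (P n).rep) = (P n).rep := by
      rw [mulVec_mulVec, mul_nonsing_inv _ hunit, one_mulVec]
    have hu0 : G⁻¹ *ᵥ (P n).rep ≠ 0 := fun h0 => (P n).rep_nonzero (by rw [← hGu, h0, mulVec_zero])
    have hu := hPA' n
    rw [← hGu, dotProduct_congr_mulVec, hGA, smul_mulVec, dotProduct_smul, smul_eq_mul,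
      mul_eq_zero, or_iff_right hγ] at hu
    rcases eq_smul_veronese_or hu0 hu with ⟨c, x, hc, h⟩ | ⟨c, hc, h⟩
    · refine ⟨x, ?_⟩
      conv_lhs => rw [← (P n).mk_rep]
      rw [conicPoint, mk_eq_mk_iff']
      exact ⟨c, by rw [← mulVec_smul, ← h, hGu]⟩
    · exfalso
      apply heP n
      conv_lhs => rw [← (P n).mk_rep]
      rw [mk_eq_mk_iff']
      exact ⟨c, by rw [← hGe, ← mulVec_smul, ← h, hGu]⟩
  choose x hx using hx
  have hxinj : Function.Injective x := fun i j hij => hinj (by rw [hx, hx, hij])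
  have hXsymm := isSymm_congr hB.1 G
  have hXdet := det_congr_ne_zero hB.2 hG
  set X := Gᵀ * B * G with hX
  have hXunit : IsUnit X.det := isUnit_iff_ne_zero.2 hXdet
  refine ⟨G, X⁻¹, hG, x, ⟨hxinj, ⟨?_, ?_⟩, fun n => ?_⟩, hx⟩
  · rw [IsSymm, transpose_nonsing_inv, hXsymm.eq]
  · rw [det_nonsing_inv, Ring.inverse_eq_inv']
    exact inv_ne_zero hXdet
  · have hne : x n ≠ x (n + 1) := fun h => h1 (by simpa using hxinj h)
    have hne' : conicPoint G hG (x n) ≠ conicPoint G hG (x (n + 1)) := fun h' =>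
      hne (conicPoint_inj.1 h')
    have htan := hPB n
    rw [conicPoint, conicPoint] at hne'
    rw [joins, Nat.cast_one, hx n, hx (n + 1), conicPoint, conicPoint, cross_mk_of_ne _ _ hne',
      isTangent_mk_iff] at htan
    obtain ⟨q, hq, hql⟩ := htan
    have hGq : G *ᵥ (G⁻¹ *ᵥ q) = q := by
      rw [mulVec_mulVec, mul_nonsing_inv _ hunit, one_mulVec]
    have hXq : X *ᵥ (G⁻¹ *ᵥ q) = (G.det * (x (n + 1) - x n)) • side x n := by
      rw [hX, ← mulVec_mulVec, hGq, ← mulVec_mulVec, hq, transpose_mulVec_cross, cross_veronese,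
        smul_smul, side]
    have hc : G.det * (x (n + 1) - x n) ≠ 0 := mul_ne_zero hG (sub_ne_zero.2 hne.symm)
    have hiso : (G⁻¹ *ᵥ q) ⬝ᵥ X *ᵥ (G⁻¹ *ᵥ q) = 0 := by
      rw [hX, ← dotProduct_congr_mulVec, hGq, hq, hql]
    have hinv : X⁻¹ *ᵥ (X *ᵥ (G⁻¹ *ᵥ q)) = G⁻¹ *ᵥ q := by
      rw [mulVec_mulVec, nonsing_inv_mul _ hXunit, one_mulVec]
    have h2 : (X *ᵥ (G⁻¹ *ᵥ q)) ⬝ᵥ X⁻¹ *ᵥ (X *ᵥ (G⁻¹ *ᵥ q)) = 0 := by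
      rw [hinv, dotProduct_comm, hiso]
    rw [hXq, mulVec_smul, dotProduct_smul, smul_dotProduct, smul_eq_mul, smul_eq_mul, mul_eq_zero,
      or_iff_right hc, mul_eq_zero, or_iff_right hc] at h2
    exact h2

end Polygons

/-! ### Movability -/

section Movability

open Matrix Projectivization

variable {𝕜 : Type*} [RCLike 𝕜] {m k : ℕ}

lemma IsContinuousPath.cross [dec : DecidableEq 𝕜] {γ δ : unitInterval → Plane 𝕜}
    (hγ : IsContinuousPath γ) (hδ : IsContinuousPath δ) (hne : ∀ t, γ t ≠ δ t) :
    IsContinuousPath fun t => (γ t).cross (δ t) := by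
  obtain ⟨v, hv, hv'⟩ := hγ
  obtain ⟨w, hw, hw'⟩ := hδ
  refine ⟨fun t => crossProduct (v t) (w t), ?_, fun t => ?_⟩
  · simp only [cross_apply]
    fun_prop
  · obtain ⟨h0, h⟩ := hv' t
    obtain ⟨h0', h'⟩ := hw' t
    have := hne t
    rw [h, h'] at this
    beta_reduce
    rw [h, h']
    exact ⟨_, cross_mk_of_ne h0 h0' this⟩

lemma isContinuousPath_conicPoint {G : Matrix (Fin 3) (Fin 3) 𝕜} (hG : G.det ≠ 0)
    {y : unitInterval → 𝕜} (hy : Continuous y) : IsContinuousPath fun t => conicPoint G hG (y t) := by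
  refine ⟨fun t => G *ᵥ veronese (y t), continuous_const.matrix_mulVec ?_, fun t => ⟨_, rfl⟩⟩
  refine continuous_pi fun i => ?_
  fin_cases i <;> simp [veronese] <;> fun_prop

variable [NeZero k] {a b : Fin k → ℕ}

/-- Along a continuous family of polygons, all rings of the construction are continuous. -/
lemma isContinuousPath_rings (hab : IsTrivialCelestialSymbol m a b)
    {Q : unitInterval → ZMod m → Plane 𝕜} (hQ : ∀ n, IsContinuousPath fun t => Q t n)
    (hcel : ∀ t, IsCelestialConfiguration a b (fun j => pointRing a b (Q t) j)
      (fun j => lineRing a b (Q t) j)) (j : ℕ) (hj : j < k) :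
    (∀ n, IsContinuousPath fun t => pointRing a b (Q t) j n) ∧
      ∀ n, IsContinuousPath fun t => lineRing a b (Q t) j n := by
  have hcast : ∀ i : ℕ, 0 < i → 2 * i < m → (i : ZMod m) ≠ 0 := fun i hi him =>
    natCast_zmod_ne_zero hi (by omega)
  have hline : ∀ j < k, (∀ n, IsContinuousPath fun t => pointRing a b (Q t) j n) →
      ∀ n, IsContinuousPath fun t => lineRing a b (Q t) j n := by
    intro j hj h n
    refine (h n).cross (dec := _) (h (n + (a (Fin.ofNat k j) : ZMod m))) fun t e => ?_
    exact hcast _ (hab.a_pos _) (hab.a_lt _) (by simpa using (hcel t).point_injective ⟨j, hj⟩ e)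
  suffices h : ∀ n, IsContinuousPath fun t => pointRing a b (Q t) j n from ⟨h, hline j hj h⟩
  induction j with
  | zero => exact hQ
  | succ j ih =>
    intro n
    have h := hline j (by omega) (ih (by omega))
    refine (h n).cross (dec := _) (h (n - (b (Fin.ofNat k j) : ZMod m))) fun t e => ?_
    have := (hcel t).line_injective ⟨j, by omega⟩ e
    exact hcast _ (hab.b_pos _) (hab.b_lt _) (sub_eq_self.1 this.symm)

lemma linearIndependent_veronese (y : Fin 3 → 𝕜) (hy : Function.Injective y) :
    LinearIndependent 𝕜 fun s => veronese (y s) := by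
  have : (fun s => veronese (y s)) = (vandermonde y).row := by
    funext s i
    fin_cases i <;> simp [veronese, vandermonde]
  rw [this]
  exact linearIndependent_rows_of_det_ne_zero (det_vandermonde_ne_zero_iff.2 hy)

lemma independent_conicPoint {G : Matrix (Fin 3) (Fin 3) 𝕜} (hG : G.det ≠ 0) {y : Fin 3 → 𝕜}
    (hy : Function.Injective y) : Independent fun s => conicPoint G hG (y s) := by
  refine Independent.mk (fun s => G *ᵥ veronese (y s)) _ ?_
  have hker : LinearMap.ker G.mulVecLin = ⊥ :=
    LinearMap.ker_eq_bot'.2 fun v hv => eq_zero_of_mulVec_eq_zero hG hv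
  exact (linearIndependent_veronese y hy).map' G.mulVecLin hker

lemma IsTrivialCelestialSymbol.five_le (hab : IsTrivialCelestialSymbol m a b) : 5 ≤ m := by
  have h1 := hab.a_ne_b 0
  have h2 := hab.a_pos 0
  have h3 := hab.b_pos 0
  have h4 := hab.a_lt 0
  have h5 := hab.b_lt 0
  omega

lemma IsPonceletPolygon.isMovable {P : ZMod m → Plane 𝕜} (hP : IsPonceletPolygon P)
    (hab : IsTrivialCelestialSymbol m a b) :
    IsMovable a b (fun j => pointRing a b P j) (fun j => lineRing a b P j) := by
  have hm := hab.five_le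
  have : NeZero m := ⟨by omega⟩
  obtain ⟨G, Ψ, hG, x, hx, hPx⟩ := hP.exists_isCircumscribed
  obtain ⟨r, y, hy, hy0, hcirc, hfix, t, n, hn⟩ := hx.exists_motion hm
  set Q : unitInterval → ZMod m → Plane 𝕜 := fun t n => conicPoint G hG (y t n) with hQ
  have hQ0 : Q 0 = P := funext fun n => by rw [hPx n, ← hy0]
  have hcel : ∀ t, IsCelestialConfiguration a b (fun j => pointRing a b (Q t) j)
      (fun j => lineRing a b (Q t) j) := fun t => by
    obtain ⟨Ψ', hΨ'⟩ := hcirc t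
    exact (pointRing_self_and_isCelestialConfiguration (hΨ'.isPonceletPolygon hm hG) hab).2
  have hcont := isContinuousPath_rings hab (Q := Q)
    (fun n => isContinuousPath_conicPoint hG ((continuous_apply n).comp hy)) hcel
  have hring : ∀ (Q : ZMod m → Plane 𝕜), pointRing a b Q ((0 : Fin k) : ℕ) = Q := fun Q => by
    rw [Fin.val_zero]
    rfl
  refine ⟨fun t j => pointRing a b (Q t) j, fun t j => lineRing a b (Q t) j,
    fun j => (hcont j j.isLt).1, fun j => (hcont j j.isLt).2, hcel, by simp only [hQ0],
    by simp only [hQ0],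
    ⟨fun s => (0, r + (s : ℕ)), fun s => ?_, fun s t => ?_⟩, t, 0, n, ?_⟩
  · simp only [hring, hPx]
    refine independent_conicPoint hG (y := fun i => x (r + (s.succAbove i : ℕ)))
      fun i j hij => s.succAbove_right_injective (Fin.ext ?_)
    by_contra hne
    exact add_ne_add hm r hne (by omega) (by omega) (hx.injective hij)
  · simp only [hring, hPx]
    exact conicPoint_congr rfl (hfix t s)
  · simp only [hring, hPx]
    exact fun h => hn (conicPoint_inj.1 h)

end Movability

end Poncelet

theorem theoremC {𝕜 : Type*} [RCLike 𝕜] (m k : ℕ) [NeZero k] (a b : Fin k → ℕ)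
    (hab : Poncelet.IsTrivialCelestialSymbol m a b)
    (P : ZMod m → Poncelet.Plane 𝕜) (hP : Poncelet.IsPonceletPolygon P) :
    Poncelet.pointRing a b P k = P ∧
    Poncelet.IsCelestialConfiguration a b
      (fun j => Poncelet.pointRing a b P j) (fun j => Poncelet.lineRing a b P j) ∧
    Poncelet.IsMovable a b
      (fun j => Poncelet.pointRing a b P j) (fun j => Poncelet.lineRing a b P j) := by
  obtain ⟨h1, h2⟩ := Poncelet.pointRing_self_and_isCelestialConfiguration hP hab
  exact ⟨h1, h2, hP.isMovable hab⟩
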